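/- Let $G$ be an undirected graph with countable vertex set $V$ (loops and multiple edges are allowed, and $G$ need not be connected), and suppose that $G$ has bounded degree: there is an integer $D$ such that for every vertex the total number of oriented edges emanating from it, counted with multiplicity, is at most $D$. Let $X=(X_n)_{n\ge 0}$ be a random walk on $G$, i.e. the Markov chain on $V$, started from an arbitrary (deterministic or random) initial vertex, that at each step moves along an oriented edge chosen uniformly at random among those emanating from its current position. Write $d$ for the graph distance on $G$, and call $m\ge 0$ a cut time for $X$ if the sets $\{X_i : 0\le i\le m\}$ and $\{X_i : i>m\}$ are disjoint. $$\text{If}\quad \liminf_{n\to\infty}\frac1n\, d(X_0,X_n)>0 \quad\text{a.s.}\quad\text{then}\quad \liminf_{n\to\infty}\frac1n\,\#\{0\le m\le n : m \text{ is a cut time for } X\}>0\quad\text{a.s.}$$ -/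

import Mathlib

open MeasureTheory Filter
open scoped ENNReal

/-- An undirected graph on the vertex set `V`, with loops and multiple edges allowed, recorded by
the number `mult u v` of oriented edges with tail `u` and head `v`. Each edge can be traversed in
both directions, whence the symmetry. A simple graph is the case in which every `mult u v` is
`0` or `1` and every `mult v v` is `0`. -/
structure EdgeGraph (V : Type*) where
  mult : V → V → ℕ
  symm : ∀ u v, mult u v = mult v u

namespace EdgeGraph

variable {V : Type*} (G : EdgeGraph V)

/-- The degree of `u`: the total number (possibly `∞`) of oriented edges emanating from `u`. -/
noncomputable def degree (u : V) : ℝ≥0∞ := ∑' v, (G.mult u v : ℝ≥0∞)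

def BoundedDegree : Prop := ∃ D : ℕ, ∀ v, G.degree v ≤ D

/-- The underlying simple graph: distinct vertices joined by at least one edge. -/
def toSimpleGraph : SimpleGraph V where
  Adj u v := u ≠ v ∧ G.mult u v ≠ 0
  symm := ⟨fun u v h => ⟨h.1.symm, by rw [G.symm v u]; exact h.2⟩⟩
  loopless := ⟨fun _ h => h.1 rfl⟩

/-- The graph distance (with value `∞` between different connected components). -/
noncomputable def gdist (u v : V) : ℝ≥0∞ := (G.toSimpleGraph.edist u v : ℝ≥0∞)

/-- The transition probabilities of the random walk on `G`: the walk leaves `u` through a uniformly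
chosen oriented edge emanating from `u`. -/
noncomputable def transition (u v : V) : ℝ≥0∞ := (G.mult u v : ℝ≥0∞) / G.degree u

/-- `X` is a random walk on `G`, with arbitrary (deterministic or random) initial vertex `X 0`:
a Markov chain with transition probabilities `G.transition`. -/
structure IsRandomWalk [MeasurableSpace V] {Ω : Type*} [MeasurableSpace Ω] (μ : Measure Ω)
    (X : ℕ → Ω → V) : Prop where
  measurable : ∀ n, Measurable (X n)
  law : ∀ (n : ℕ) (x : ℕ → V),
    μ {ω | ∀ i ≤ n, X i ω = x i} =
      μ {ω | X 0 ω = x 0} * ∏ i ∈ Finset.range n, G.transition (x i) (x (i + 1))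

end EdgeGraph

/-- `n` is a cut time of the sequence `x`: `{x i : i ≤ n}` and `{x i : i > n}` are disjoint. -/
def IsCutTime {V : Type*} (x : ℕ → V) (n : ℕ) : Prop :=
  Disjoint (x '' Set.Iic n) (x '' Set.Ioi n)

/-- The number of cut times `m` of `x` with `0 ≤ m ≤ n`. -/
noncomputable def cutTimeCount {V : Type*} (x : ℕ → V) (n : ℕ) : ℕ :=
  Set.ncard {m : ℕ | m ≤ n ∧ IsCutTime x m}

/-! Fix the starting vertex `o` and let h be the Green function with pole `o`, truncated at 1. It is
superharmonic, equals 1 at `o`, and changes by a factor of at most D along an edge. If every visit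
to {h ≥ a} precedes every visit to {h < a}, then the time of the passage below a is a cut time. So
it suffices to find linearly many levels a that are crossed once and for all, without too many of
them sharing the same crossing time.

Exponential decay. At positive speed, h(X_n) < β^n eventually, for some β < 1
(`eventually_potential_lt`). A Carne–Varopoulos bound (`exists_iterate_average_le`) and
reversibility make P(X_n = x) at most a constant times β^(2n) on the vertices x with n ≤ k·d(o,x).
If moreover h(x) ≥ β^n, this is at most a constant times β^n·green(x). The sum over the ball of
radius n of green(x) times the probability of escaping from x at speed 1/k is O(n), because it is
controlled by the expected number of times at which the walk is in the ball and starts such an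
escape (`tsum_green_mul_escapeProb_le`). Borel–Cantelli concludes.

Counting levels. With η = √β, the sequence h(X_i) starts at 1 and is below all levels η^j, j < 2n,
at time n. The first descent below a level a lands either in (ηa, a), which a given step can do for
only one level, so that at most n levels are lost in this way, or at or below ηa. In the second case
the supermartingale property makes a return to a unlikely: the score, which is h/a − η until the
return and 1 − η from then on, is a supermartingale. The scores of all levels together have bounded
increments, because at any time the contributions of the levels decay geometrically away from the
current value of h. An exponential moment bound thus keeps the total score below (1 − η)n/2 for
large n (`eventually_totalScore_le`). This forces at least (1 − η)n/2 levels to have been crossed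
with no return (`le_card_alive`). A step lowers h by a factor of at most D, so each cut time serves
boundedly many levels (`card_alive_le_mul_cutTimeCount`). -/

section CountableFibres

variable {Ω C : Type*} [MeasurableSpace Ω] [Countable C] [MeasurableSpace C]
  [MeasurableSingletonClass C]

lemma lintegral_eq_tsum_fibres (ν : Measure Ω) {Z : Ω → C} (hZ : Measurable Z) (f : Ω → ℝ≥0∞) :
    ∫⁻ ω, f ω ∂ν = ∑' c, ∫⁻ ω in {ω | Z ω = c}, f ω ∂ν := by
  rw [← lintegral_iUnion (s := fun c => {ω | Z ω = c})
    (fun c => hZ (measurableSet_singleton c))]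
  · have h2 : (⋃ c, {ω | Z ω = c}) = Set.univ := by ext ω; simp
    rw [h2, Measure.restrict_univ]
  · intro a b hab
    refine Set.disjoint_left.2 fun ω h1 h2 => hab ?_
    exact Eq.trans (Eq.symm h1) h2

end CountableFibres

/-! ### The Markov property -/

namespace EdgeGraph

section PathSpace

variable {V : Type*} [MeasurableSpace V] {G : EdgeGraph V} {Ω : Type*} [MeasurableSpace Ω]
  {ν : Measure Ω} {X : ℕ → Ω → V}

lemma IsRandomWalk.law_succ (hX : G.IsRandomWalk ν X) (n : ℕ) (x : ℕ → V) :
    ν {ω | (∀ i ≤ n, X i ω = x i) ∧ X (n + 1) ω = x (n + 1)} =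
      ν {ω | ∀ i ≤ n, X i ω = x i} * G.transition (x n) (x (n + 1)) := by
  have h1 := hX.law (n + 1) x
  rw [Finset.prod_range_succ, ← mul_assoc, ← hX.law n x] at h1
  rw [← h1]
  congr 1
  ext ω
  constructor
  · rintro ⟨h, h'⟩ i hi
    rcases Nat.le_succ_iff.1 hi with hi | rfl
    · exact h i hi
    · exact h'
  · exact fun h => ⟨fun i hi => h i (by omega), h _ le_rfl⟩

/-- The prefix of length `n + 1` of a path. -/
def pathPrefix (X : ℕ → Ω → V) (n : ℕ) (ω : Ω) : Set.Iic n → V := fun i => X i ω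

lemma IsRandomWalk.measurable_pathPrefix (hX : G.IsRandomWalk ν X) (n : ℕ) :
    Measurable (pathPrefix X n) :=
  measurable_pi_lambda _ fun i => hX.measurable i

variable [Countable V] [DiscreteMeasurableSpace V]

/-- There are countably many prefixes, and on the event that the prefix takes a given value both `F`
and `X n` are constant, so that `law_succ` gives the identity prefix by prefix. -/
lemma IsRandomWalk.setLIntegral_succ (hX : G.IsRandomWalk ν X) (n : ℕ) (y : V)
    {F : (ℕ → V) → ℝ≥0∞} (hF : DependsOn F (Set.Iic n)) :
    ∫⁻ ω in {ω | X (n + 1) ω = y}, F (fun i => X i ω) ∂ν =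
      ∫⁻ ω, G.transition (X n ω) y * F (fun i => X i ω) ∂ν := by
  have hm : ∀ w, MeasurableSet {ω | pathPrefix X n ω = w} := fun w =>
    hX.measurable_pathPrefix n (measurableSet_singleton w)
  rw [lintegral_eq_tsum_fibres _ (hX.measurable_pathPrefix n),
    lintegral_eq_tsum_fibres ν (hX.measurable_pathPrefix n)]
  congr 1
  ext w
  -- Extending the prefix by `y` makes `x (n + 1) = y`, as `law_succ` needs.
  set x : ℕ → V := fun i => if h : i ≤ n then w ⟨i, h⟩ else y with hx
  have hset : {ω | pathPrefix X n ω = w} = {ω | ∀ i ≤ n, X i ω = x i} := by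
    ext ω
    simp only [Set.mem_ofPred_eq, funext_iff, pathPrefix, Subtype.forall, Set.mem_Iic]
    refine forall₂_congr fun i hi => ?_
    simp [hx, hi]
  have hFx : ∀ ω ∈ {ω | pathPrefix X n ω = w}, F (fun i => X i ω) = F x := by
    intro ω hω
    rw [hset] at hω
    exact hF fun i hi => hω i hi
  have hxn : ∀ ω ∈ {ω | pathPrefix X n ω = w}, X n ω = x n := by
    intro ω hω
    rw [hset] at hω
    exact hω n le_rfl
  rw [setLIntegral_congr_fun (g := fun _ => F x) (hm w) fun ω hω => hFx ω hω,
    setLIntegral_congr_fun (g := fun _ => G.transition (x n) y * F x) (hm w)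
      fun ω hω => congrArg₂ (fun a b => G.transition a y * b) (hxn ω hω) (hFx ω hω)]
  rw [lintegral_const, lintegral_const, Measure.restrict_restrict (hm w),
    Measure.restrict_apply_univ, Measure.restrict_apply_univ]
  have h := hX.law_succ n x
  have hy : x (n + 1) = y := by simp [hx]
  rw [hy] at h
  rw [hset]
  have : {ω | ∀ i ≤ n, X i ω = x i} ∩ {ω | X (n + 1) ω = y} =
      {ω | (∀ i ≤ n, X i ω = x i) ∧ X (n + 1) ω = y} := rfl
  rw [this, h]
  ring

lemma IsRandomWalk.measurable_comp (hX : G.IsRandomWalk ν X) (n : ℕ) {F : (ℕ → V) → ℝ≥0∞}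
    (hF : DependsOn F (Set.Iic n)) : Measurable fun ω => F fun i => X i ω := by
  rcases isEmpty_or_nonempty V with hV | ⟨⟨v⟩⟩
  · have : IsEmpty Ω := ⟨fun ω => hV.elim (X 0 ω)⟩
    exact measurable_of_empty _
  have : (fun ω => F (fun i => X i ω)) =
      (fun w : Set.Iic n → V => F (fun i => if h : i ≤ n then w ⟨i, h⟩ else v)) ∘
        pathPrefix X n := by
    ext ω
    refine hF fun i hi => ?_
    have : i ≤ n := hi
    simp [pathPrefix, this]
  rw [this]
  exact (measurable_of_countable _).comp (hX.measurable_pathPrefix n)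

/-- The Markov property, one step at a time. -/
lemma IsRandomWalk.lintegral_succ (hX : G.IsRandomWalk ν X) (n : ℕ)
    {f : (ℕ → V) → ℝ≥0∞} (hf : DependsOn f (Set.Iic (n + 1))) :
    ∫⁻ ω, f (fun i => X i ω) ∂ν =
      ∫⁻ ω, ∑' y, G.transition (X n ω) y * f (Function.update (fun i => X i ω) (n + 1) y) ∂ν := by
  have hdep : ∀ y, DependsOn (fun x => f (Function.update x (n + 1) y)) (Set.Iic n) := by
    intro y x x' h
    refine hf fun i hi => ?_
    rcases Nat.le_succ_iff.1 (Set.mem_Iic.1 hi) with hi | rfl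
    · rw [Function.update_of_ne (by omega), Function.update_of_ne (by omega)]
      exact h i hi
    · simp
  rw [lintegral_eq_tsum_fibres ν (hX.measurable (n + 1)), lintegral_tsum]
  · congr 1
    ext y
    rw [← hX.setLIntegral_succ n y (hdep y)]
    refine setLIntegral_congr_fun (hX.measurable (n + 1) (measurableSet_singleton y)) ?_
    intro ω hω
    have hω' : X (n + 1) ω = y := hω
    have : Function.update (fun i => X i ω) (n + 1) y = fun i => X i ω := by
      rw [← hω']; exact Function.update_eq_self _ _
    simp only [this]
  · intro y
    refine Measurable.aemeasurable ?_
    exact ((measurable_of_countable (fun x => G.transition x y)).comp (hX.measurable n)).mul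
      (hX.measurable_comp n (hdep y))

/-- The probability, started from `x`, that the first `k + 1` steps of the walk lie in the given
sets. -/
noncomputable def stayProb (G : EdgeGraph V) : ℕ → (ℕ → Set V) → V → ℝ≥0∞
  | 0, S => (S 0).indicator 1
  | k + 1, S => (S 0).indicator fun x =>
      ∑' y, G.transition x y * stayProb G k (fun j => S (j + 1)) y

-- The induction absorbs the constraint at time `m` into the weight `F` and moves the remaining ones
-- to time `m + 1`; this is why `m`, `S` and `F` are quantified inside.
open Classical in
lemma IsRandomWalk.lintegral_stay (hX : G.IsRandomWalk ν X) (k : ℕ) : ∀ (m : ℕ) (S : ℕ → Set V)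
    (F : (ℕ → V) → ℝ≥0∞), DependsOn F (Set.Iic m) →
    ∫⁻ ω, F (fun i => X i ω) * (if ∀ j ≤ k, X (m + j) ω ∈ S j then 1 else 0) ∂ν =
      ∫⁻ ω, F (fun i => X i ω) * G.stayProb k S (X m ω) ∂ν := by
  induction k with
  | zero =>
    intro m S F _
    simp [stayProb, Set.indicator_apply]
  | succ k ih =>
    intro m S F hF
    set F' : (ℕ → V) → ℝ≥0∞ := fun x => F x * if x m ∈ S 0 then 1 else 0 with hF'
    have hF'm : DependsOn F' (Set.Iic m) := by
      intro x x' h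
      simp only [hF', hF h, h m (Set.mem_Iic.2 le_rfl)]
    have hF's : DependsOn F' (Set.Iic (m + 1)) := fun x x' h =>
      hF'm fun i hi => h i (Set.mem_Iic.2 ((Set.mem_Iic.1 hi).trans (Nat.le_succ m)))
    have hG : DependsOn (fun x : ℕ → V => F' x * G.stayProb k (fun j => S (j + 1)) (x (m + 1)))
        (Set.Iic (m + 1)) := by
      intro x x' h
      simp only [hF's h, h (m + 1) (Set.mem_Iic.2 le_rfl)]
    calc _ = ∫⁻ ω, F' (fun i => X i ω) *
          (if ∀ j ≤ k, X (m + 1 + j) ω ∈ S (j + 1) then 1 else 0) ∂ν := by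
          congr 1
          ext ω
          simp only [hF', mul_assoc]
          congr 1
          have : (∀ j ≤ k + 1, X (m + j) ω ∈ S j) ↔
              X m ω ∈ S 0 ∧ ∀ j ≤ k, X (m + 1 + j) ω ∈ S (j + 1) := by
            constructor
            · intro h
              refine ⟨h 0 (by omega), fun j hj => ?_⟩
              have := h (j + 1) (by omega)
              rwa [show m + (j + 1) = m + 1 + j by omega] at this
            · rintro ⟨h0, h⟩ j hj
              rcases j with _ | j
              · exact h0
              · have := h j (by omega)
                rwa [show m + 1 + j = m + (j + 1) by omega] at this
          by_cases h0 : X m ω ∈ S 0 <;> simp [this, h0]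
      _ = ∫⁻ ω, F' (fun i => X i ω) * G.stayProb k (fun j => S (j + 1)) (X (m + 1) ω) ∂ν :=
          ih (m + 1) _ F' hF's
      _ = _ := by
          rw [hX.lintegral_succ m hG]
          congr 1
          ext ω
          have h1 : ∀ y, F' (Function.update (fun i => X i ω) (m + 1) y) =
              F' fun i => X i ω := by
            intro y
            refine hF'm fun i hi => ?_
            rw [Function.update_of_ne]
            have := Set.mem_Iic.1 hi
            omega
          simp only [h1, Function.update_self]
          simp only [hF', stayProb, Set.indicator_apply]
          by_cases h0 : X m ω ∈ S 0
          · simp only [h0, if_true, mul_one]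
            rw [← ENNReal.tsum_mul_left]
            congr 1
            ext y
            ring
          · simp [h0]

lemma IsRandomWalk.measurableSet_stay (hX : G.IsRandomWalk ν X) (m : ℕ) (x : V) (S : ℕ → Set V)
    (k : ℕ) : MeasurableSet {ω | X m ω = x ∧ ∀ j ≤ k, X (m + j) ω ∈ S j} := by
  have : {ω | X m ω = x ∧ ∀ j ≤ k, X (m + j) ω ∈ S j} =
      X m ⁻¹' {x} ∩ ⋂ j, ⋂ (_ : j ≤ k), X (m + j) ⁻¹' S j := by
    ext ω; simp
  rw [this]
  exact (hX.measurable m (measurableSet_singleton x)).inter <|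
    MeasurableSet.iInter fun j => MeasurableSet.iInter fun _ =>
      hX.measurable _ (MeasurableSet.of_discrete)

lemma IsRandomWalk.measure_stay (hX : G.IsRandomWalk ν X) (m : ℕ) (x : V) (S : ℕ → Set V)
    (k : ℕ) :
    ν {ω | X m ω = x ∧ ∀ j ≤ k, X (m + j) ω ∈ S j} =
      ν {ω | X m ω = x} * G.stayProb k S x := by
  classical
  have hF : DependsOn (fun z : ℕ → V => if z m = x then (1 : ℝ≥0∞) else 0) (Set.Iic m) := by
    intro z z' h
    simp only [h m (Set.mem_Iic.2 le_rfl)]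
  have h := hX.lintegral_stay k m S _ hF
  have hm : MeasurableSet {ω | X m ω = x} := hX.measurable m (measurableSet_singleton x)
  have hm' := hX.measurableSet_stay m x S k
  calc _ = ∫⁻ ω, {ω | X m ω = x ∧ ∀ j ≤ k, X (m + j) ω ∈ S j}.indicator 1 ω ∂ν := by
        rw [lintegral_indicator_one hm']
    _ = _ := by
        rw [← mul_comm, ← lintegral_indicator_const hm]
        convert h using 2
        · ext ω
          simp only [Set.indicator_apply, Set.mem_ofPred_eq, Pi.one_apply]
          by_cases h1 : X m ω = x <;> simp [h1]
        · ext ω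
          simp only [Set.indicator_apply, Set.mem_ofPred_eq]
          by_cases h1 : X m ω = x <;> simp [h1]

lemma IsRandomWalk.measure_stay_forever [IsFiniteMeasure ν] (hX : G.IsRandomWalk ν X) (m : ℕ)
    (x : V) (S : ℕ → Set V) :
    ν {ω | X m ω = x ∧ ∀ j, X (m + j) ω ∈ S j} =
      ν {ω | X m ω = x} * ⨅ k, G.stayProb k S x := by
  have hset : {ω | X m ω = x ∧ ∀ j, X (m + j) ω ∈ S j} =
      ⋂ k, {ω | X m ω = x ∧ ∀ j ≤ k, X (m + j) ω ∈ S j} := by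
    ext ω
    simp only [Set.mem_ofPred_eq, Set.mem_iInter]
    exact ⟨fun h k => ⟨h.1, fun j _ => h.2 j⟩, fun h => ⟨(h 0).1, fun j => (h j).2 j le_rfl⟩⟩
  have hanti : Antitone fun k => {ω | X m ω = x ∧ ∀ j ≤ k, X (m + j) ω ∈ S j} := by
    intro a b hab ω h
    exact ⟨h.1, fun j hj => h.2 j (hj.trans hab)⟩
  rw [hset, Antitone.measure_iInter hanti
    (fun k => (hX.measurableSet_stay m x S k).nullMeasurableSet) ⟨0, measure_ne_top _ _⟩,
    ENNReal.mul_iInf fun h => absurd h (measure_ne_top _ _)]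
  simp only [hX.measure_stay]

end PathSpace

end EdgeGraph

/-! ### A Carne–Varopoulos bound through the discrete wave equation -/

namespace EdgeGraph

section Chebyshev

variable {V : Type*} {G : EdgeGraph V}

/-- Every vertex has finitely many neighbours. -/
def LocallyFinite (G : EdgeGraph V) : Prop := ∀ x, {y | G.mult x y ≠ 0}.Finite

lemma locallyFinite_of_degree_le {D : ℕ} (hD : ∀ v, G.degree v ≤ D) : G.LocallyFinite := by
  intro x
  have h : ∑' y, (G.mult x y : ℝ≥0∞) ≠ ∞ := ((hD x).trans_lt (by simp)).ne
  refine (ENNReal.finite_const_le_of_tsum_ne_top h one_ne_zero).subset fun y hy => ?_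
  have : 1 ≤ G.mult x y := Nat.one_le_iff_ne_zero.2 hy
  simpa using (by exact_mod_cast this : (1 : ℝ≥0∞) ≤ G.mult x y)

/-- The degree as a real number. -/
noncomputable def realDegree (G : EdgeGraph V) (x : V) : ℝ := ∑' y, (G.mult x y : ℝ)

/-- The mean of `f` over the neighbours of a vertex. -/
noncomputable def average (G : EdgeGraph V) (f : V → ℝ) (x : V) : ℝ :=
  (∑' y, (G.mult x y : ℝ) * f y) / G.realDegree x

namespace LocallyFinite

variable (hG : G.LocallyFinite)
include hG

lemma summable_mult_mul (x : V) (f : V → ℝ) : Summable fun y => (G.mult x y : ℝ) * f y :=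
  summable_of_hasFiniteSupport <| (hG x).subset fun y hy h => hy (by simp [h])

lemma summable_mult (x : V) : Summable fun y => (G.mult x y : ℝ) := by
  simpa using hG.summable_mult_mul x 1

lemma realDegree_eq_zero {x : V} (h : G.realDegree x = 0) (y : V) : G.mult x y = 0 := by
  have := (hG.summable_mult x).le_tsum y fun _ _ => Nat.cast_nonneg _
  rw [← realDegree, h] at this
  exact Nat.le_zero.1 (by exact_mod_cast this)

lemma realDegree_mul_average (f : V → ℝ) (x : V) :
    G.realDegree x * G.average f x = ∑' y, (G.mult x y : ℝ) * f y := by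
  rw [average]
  by_cases h : G.realDegree x = 0
  · simp [hG.realDegree_eq_zero h]
  · field_simp

lemma average_half_add (f g : V → ℝ) :
    G.average (fun x => (f x + g x) / 2) = fun x => (G.average f x + G.average g x) / 2 := by
  ext x
  have : ∀ y, (G.mult x y : ℝ) * ((f y + g y) / 2) =
      ((G.mult x y : ℝ) * f y + (G.mult x y : ℝ) * g y) / 2 := fun y => by ring
  simp only [average, this, tsum_div_const]
  rw [(hG.summable_mult_mul x f).tsum_add (hG.summable_mult_mul x g)]
  ring

lemma iterate_average_half_add (n : ℕ) : ∀ f g : V → ℝ,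
    G.average^[n] (fun x => (f x + g x) / 2) =
      fun x => (G.average^[n] f x + G.average^[n] g x) / 2 := by
  induction n with
  | zero => intro f g; rfl
  | succ n ih =>
    intro f g
    simp only [Function.iterate_succ_apply, hG.average_half_add, ih]

end LocallyFinite

lemma exists_of_average_ne_zero {f : V → ℝ} {x : V} (h : G.average f x ≠ 0) :
    ∃ y, G.mult x y ≠ 0 ∧ f y ≠ 0 := by
  by_contra! H
  refine h ?_
  have : ∀ y, (G.mult x y : ℝ) * f y = 0 := by
    intro y
    by_cases hy : G.mult x y = 0
    · simp [hy]
    · simp [H y hy]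
  simp [average, this]

lemma LocallyFinite.finite_support_average (hG : G.LocallyFinite) {f : V → ℝ}
    (hf : f.support.Finite) : (G.average f).support.Finite := by
  refine (hf.biUnion fun y _ => hG y).subset fun x hx => ?_
  obtain ⟨y, h1, h2⟩ := exists_of_average_ne_zero hx
  simp only [Set.mem_iUnion]
  exact ⟨y, h2, by rw [G.symm] at h1; exact h1⟩

lemma edist_le_of_mult_ne_zero (o : V) {x y : V} (h : G.mult x y ≠ 0) :
    G.toSimpleGraph.edist o x ≤ G.toSimpleGraph.edist o y + 1 := by
  by_cases hxy : x = y
  · subst hxy; exact le_self_add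
  · have hadj : G.toSimpleGraph.Adj y x := ⟨Ne.symm hxy, by rwa [G.symm]⟩
    refine SimpleGraph.edist_triangle.trans (add_le_add le_rfl ?_)
    exact (SimpleGraph.edist_eq_one_iff_adj.2 hadj).le

open Classical in
/-- The Chebyshev polynomials of the averaging operator, applied to the unit mass at `o`:
the solution of the discrete wave equation with this initial value. -/
noncomputable def chebyshev (G : EdgeGraph V) (o : V) : ℕ → V → ℝ
  | 0 => Pi.single o 1
  | 1 => G.average (Pi.single o 1)
  | k + 2 => fun x => 2 * G.average (chebyshev G o (k + 1)) x - chebyshev G o k x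

lemma average_chebyshev_zero (o : V) :
    G.average (G.chebyshev o 0) = G.chebyshev o 1 := rfl

lemma average_chebyshev_succ (o : V) (k : ℕ) :
    G.average (G.chebyshev o (k + 1)) =
      fun x => (G.chebyshev o (k + 2) x + G.chebyshev o k x) / 2 := by
  ext x
  simp [chebyshev]

/-- Finite propagation speed: one averaging enlarges the support by at most one unit of distance. -/
lemma chebyshev_support (o : V) (k : ℕ) : ∀ x, G.chebyshev o k x ≠ 0 →
    G.toSimpleGraph.edist o x ≤ k := by
  have key : ∀ (k : ℕ) (f : V → ℝ), (∀ x, f x ≠ 0 → G.toSimpleGraph.edist o x ≤ k) →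
      ∀ x, G.average f x ≠ 0 → G.toSimpleGraph.edist o x ≤ (k + 1 : ℕ) := by
    intro k f hf x hx
    obtain ⟨y, h1, h2⟩ := exists_of_average_ne_zero hx
    refine (edist_le_of_mult_ne_zero o h1).trans ?_
    push_cast
    exact add_le_add (hf y h2) le_rfl
  induction k using Nat.strong_induction_on with
  | _ k ih =>
    match k, ih with
    | 0, _ =>
      intro x hx
      have : x = o := by
        by_contra hne
        exact hx (by simp [chebyshev, hne])
      simp [this]
    | 1, ih => exact key 0 _ (ih 0 one_pos)
    | k + 2, ih =>
      intro x hx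
      by_cases h : G.chebyshev o k x = 0
      · refine key (k + 1) _ (ih (k + 1) (by omega)) x fun h0 => hx ?_
        simp [chebyshev, h, h0]
      · refine (ih k (by omega) x h).trans ?_
        exact_mod_cast (by omega : k ≤ k + 2)

/-- The energy of a pair of consecutive values of a solution of the discrete wave equation. -/
noncomputable def waveEnergy (G : EdgeGraph V) (f g : V → ℝ) : ℝ :=
  ∑' p : V × V, (G.mult p.1 p.2 : ℝ) * (f p.1 - g p.2) ^ 2

namespace LocallyFinite

variable (hG : G.LocallyFinite)
include hG

lemma finite_support_chebyshev (o : V) (k : ℕ) : (G.chebyshev o k).support.Finite := by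
  have h0 : (G.chebyshev o 0).support.Finite := by
    refine (Set.finite_singleton o).subset fun x hx => ?_
    by_contra hne
    exact hx (by simp [chebyshev, show x ≠ o from hne])
  have h : (G.chebyshev o k).support.Finite ∧ (G.chebyshev o (k + 1)).support.Finite := by
    induction k with
    | zero => exact ⟨h0, hG.finite_support_average h0⟩
    | succ k ih =>
      refine ⟨ih.2, ((hG.finite_support_average ih.2).union ih.1).subset fun x hx => ?_⟩
      by_contra hne
      simp only [Set.mem_union, Function.mem_support, not_or, not_not] at hne
      exact hx (by simp [chebyshev, hne.1, hne.2])
  exact h.1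

lemma finite_edges {f g : V → ℝ} (hf : f.support.Finite) (hg : g.support.Finite) :
    {p : V × V | G.mult p.1 p.2 ≠ 0 ∧ (f p.1 ≠ 0 ∨ g p.2 ≠ 0)}.Finite := by
  refine ((hf.biUnion fun x _ => (Set.finite_singleton x).prod (hG x)).union
    (hg.biUnion fun y _ => (hG y).prod (Set.finite_singleton y))).subset ?_
  rintro ⟨x, y⟩ ⟨h1, h2 | h2⟩
  · refine Or.inl (Set.mem_biUnion (show x ∈ f.support from h2) ⟨rfl, h1⟩)
  · refine Or.inr (Set.mem_biUnion (show y ∈ g.support from h2) ⟨?_, rfl⟩)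
    have h1' : G.mult x y ≠ 0 := h1
    rw [G.symm] at h1'
    exact h1'

lemma summable_waveEnergy {f g : V → ℝ} (hf : f.support.Finite) (hg : g.support.Finite) :
    Summable fun p : V × V => (G.mult p.1 p.2 : ℝ) * (f p.1 - g p.2) ^ 2 := by
  refine summable_of_hasFiniteSupport ((hG.finite_edges hf hg).subset fun p hp => ⟨?_, ?_⟩)
  · intro h; exact hp (by simp [h])
  · by_contra! h; exact hp (by simp [h.1, h.2])

omit hG in
lemma _root_.EdgeGraph.waveEnergy_comm (f g : V → ℝ) : G.waveEnergy f g = G.waveEnergy g f := by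
  rw [waveEnergy, ← (Equiv.prodComm V V).tsum_eq]
  refine tsum_congr fun p => ?_
  simp only [Equiv.prodComm_apply, Prod.fst_swap, Prod.snd_swap]
  rw [G.symm]
  ring

/-- Conservation of energy: (f x − g y)² − (h x − g y)² = (f x − h x)(f x + h x − 2 g y), and
summing the last factor over the edges at x gives zero by the wave equation. Finite supports justify
the rearrangements. -/
lemma waveEnergy_step {f g h : V → ℝ} (hf : f.support.Finite) (hg : g.support.Finite)
    (hh : h.support.Finite) (hw : ∀ x, f x + h x = 2 * G.average g x) :
    G.waveEnergy f g = G.waveEnergy g h := by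
  rw [G.waveEnergy_comm g h, ← sub_eq_zero, waveEnergy, waveEnergy,
    ← (hG.summable_waveEnergy hf hg).tsum_sub (hG.summable_waveEnergy hh hg)]
  have hs := (hG.summable_waveEnergy hf hg).sub (hG.summable_waveEnergy hh hg)
  have hterm : ∀ x y, (G.mult x y : ℝ) * (f x - g y) ^ 2 - (G.mult x y : ℝ) * (h x - g y) ^ 2 =
      (f x - h x) * ((G.mult x y : ℝ) * (f x + h x) - 2 * ((G.mult x y : ℝ) * g y)) := by
    intro x y; ring
  rw [hs.tsum_prod' fun x => ?_]
  · rw [← tsum_zero (β := V)]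
    refine tsum_congr fun x => ?_
    simp only [hterm]
    rw [tsum_mul_left, Summable.tsum_sub ((hG.summable_mult x).mul_right _)
      ((hG.summable_mult_mul x g).mul_left _), tsum_mul_right, tsum_mul_left,
      ← hG.realDegree_mul_average, hw, ← realDegree]
    ring
  · simp only [hterm]
    exact (((hG.summable_mult x).mul_right _).sub
      ((hG.summable_mult_mul x g).mul_left _)).mul_left _

lemma waveEnergy_chebyshev (o : V) (k : ℕ) :
    G.waveEnergy (G.chebyshev o (k + 1)) (G.chebyshev o k) =
      G.waveEnergy (G.chebyshev o 1) (G.chebyshev o 0) := by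
  induction k with
  | zero => rfl
  | succ k ih =>
    rw [← ih]
    refine hG.waveEnergy_step (hG.finite_support_chebyshev o _) (hG.finite_support_chebyshev o _)
      (hG.finite_support_chebyshev o _) fun x => ?_
    rw [average_chebyshev_succ]
    ring

/-- By conservation of energy, consecutive solutions evaluated at the two ends of an edge differ by
at most the square root of the initial energy. The resulting linear growth is harmless against the
exponentials below. -/
lemma abs_chebyshev_le (o : V) (k : ℕ) : ∀ x, (∃ y, G.mult x y ≠ 0) → |G.chebyshev o k x| ≤
      1 + k * √(G.waveEnergy (G.chebyshev o 1) (G.chebyshev o 0)) := by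
  induction k with
  | zero =>
    intro x _
    by_cases h : x = o
    · subst h; simp [chebyshev]
    · simp [chebyshev, h]
  | succ k ih =>
    rintro x ⟨y, hy⟩
    have h1 := ih y ⟨x, by rwa [G.symm]⟩
    have h2 : (G.chebyshev o (k + 1) x - G.chebyshev o k y) ^ 2 ≤
        G.waveEnergy (G.chebyshev o 1) (G.chebyshev o 0) := by
      rw [← hG.waveEnergy_chebyshev o k]
      refine le_trans ?_ ((hG.summable_waveEnergy (hG.finite_support_chebyshev o _)
        (hG.finite_support_chebyshev o _)).le_tsum (x, y) fun p _ => by positivity)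
      have : (1 : ℝ) ≤ G.mult x y := by exact_mod_cast Nat.one_le_iff_ne_zero.2 hy
      nlinarith [sq_nonneg (G.chebyshev o (k + 1) x - G.chebyshev o k y)]
    have h3 := Real.abs_le_sqrt h2
    have h4 : |G.chebyshev o (k + 1) x| ≤
        |G.chebyshev o (k + 1) x - G.chebyshev o k y| + |G.chebyshev o k y| := by
      simpa using abs_add_le (G.chebyshev o (k + 1) x - G.chebyshev o k y) (G.chebyshev o k y)
    push_cast
    linarith

/-- A bound of Carne–Varopoulos type on the transition probabilities. -/
lemma exists_iterate_average_le (o : V) {l : ℝ} (hl : 0 < l) :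
    ∃ K : ℝ, 0 ≤ K ∧ ∀ (x : V) (d : ℝ), (∃ y, G.mult x y ≠ 0) →
      (∀ k : ℕ, G.toSimpleGraph.edist o x ≤ k → d ≤ k) → ∀ n : ℕ,
      |G.average^[n] (G.chebyshev o 0) x| ≤ K * Real.exp (-(l * d)) * Real.cosh (2 * l) ^ n := by
  set S := √(G.waveEnergy (G.chebyshev o 1) (G.chebyshev o 0))
  have hS : 0 ≤ S := Real.sqrt_nonneg _
  -- The factor `1 + S / l` comes from 1 + jS ≤ (1 + S/l)(1 + lj) ≤ (1 + S/l)e^{lj}, and the factor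
  -- 2 from e^u ≤ 2 cosh u. The real number `d` is a lower bound for a distance that may be
  -- infinite.
  refine ⟨2 * (1 + S / l), by positivity, fun x d hx hd n => ?_⟩
  have hbase : ∀ j, |G.chebyshev o j x| ≤
      2 * (1 + S / l) * Real.exp (-(l * d)) * Real.cosh (2 * l * j) := by
    intro j
    by_cases h0 : G.chebyshev o j x = 0
    · rw [h0, abs_zero]
      have := Real.cosh_pos (2 * l * j)
      positivity
    have hdj := hd j (chebyshev_support o j x h0)
    have h1 : 1 + j * S ≤ (1 + S / l) * Real.exp (l * j) := by
      have h2 : 1 + l * j ≤ Real.exp (l * j) := by linarith [Real.add_one_le_exp (l * j)]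
      have h3 : 1 + j * S ≤ (1 + S / l) * (1 + l * j) := by
        have : (1 + S / l) * (1 + l * j) = 1 + j * S + (l * j + S / l) := by field_simp; ring
        rw [this]
        have : 0 ≤ l * j + S / l := by positivity
        linarith
      exact h3.trans (mul_le_mul_of_nonneg_left h2 (by positivity))
    have h4 : Real.exp (l * j) ≤ Real.exp (-(l * d)) * (2 * Real.cosh (2 * l * j)) := by
      rw [Real.cosh_eq]
      have : Real.exp (l * j) ≤ Real.exp (-(l * d)) * Real.exp (2 * l * j) := by
        rw [← Real.exp_add]
        refine Real.exp_le_exp.2 ?_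
        nlinarith
      refine this.trans (mul_le_mul_of_nonneg_left ?_ (Real.exp_pos _).le)
      linarith [Real.exp_pos (-(2 * l * j))]
    calc _ ≤ 1 + j * S := hG.abs_chebyshev_le o j x hx
      _ ≤ (1 + S / l) * (Real.exp (-(l * d)) * (2 * Real.cosh (2 * l * j))) :=
        h1.trans (mul_le_mul_of_nonneg_left h4 (by positivity))
      _ = _ := by ring
  -- Averaging replaces index j by the mean of j + 1 and j − 1, and the same operation multiplies
  -- cosh(2lj) by cosh(2l); hence the bound propagates in n for all j at once.
  have hn : ∀ n j, |G.average^[n] (G.chebyshev o j) x| ≤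
      2 * (1 + S / l) * Real.exp (-(l * d)) * Real.cosh (2 * l) ^ n * Real.cosh (2 * l * j) := by
    intro n
    induction n with
    | zero => intro j; simpa using hbase j
    | succ n ih =>
      intro j
      rw [Function.iterate_succ_apply]
      rcases j with _ | j
      · rw [average_chebyshev_zero]
        refine (ih 1).trans (le_of_eq ?_)
        simp
        ring
      · rw [average_chebyshev_succ, hG.iterate_average_half_add]
        have h1 := ih (j + 2)
        have h2 := ih j
        have h3 : Real.cosh (2 * l * (j + 2 : ℕ)) + Real.cosh (2 * l * j) =
            2 * (Real.cosh (2 * l) * Real.cosh (2 * l * (j + 1 : ℕ))) := by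
          have e1 : 2 * l * ((j + 2 : ℕ) : ℝ) = 2 * l * (j + 1 : ℕ) + 2 * l := by push_cast; ring
          have e2 : 2 * l * (j : ℝ) = 2 * l * (j + 1 : ℕ) - 2 * l := by push_cast; ring
          rw [e1, e2, Real.cosh_add, Real.cosh_sub]
          ring
        rw [abs_div, abs_two]
        have h5 := abs_add_le (G.average^[n] (G.chebyshev o (j + 2)) x)
          (G.average^[n] (G.chebyshev o j) x)
        have h6 : 2 * (1 + S / l) * Real.exp (-(l * d)) * Real.cosh (2 * l) ^ (n + 1) *
            Real.cosh (2 * l * (j + 1 : ℕ)) = 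
            2 * (1 + S / l) * Real.exp (-(l * d)) * Real.cosh (2 * l) ^ n *
            (2 * (Real.cosh (2 * l) * Real.cosh (2 * l * (j + 1 : ℕ)))) / 2 := by ring
        rw [h6, ← h3]
        linarith
  simpa using hn n 0

end LocallyFinite

end Chebyshev

end EdgeGraph

/-! ### The truncated Green function -/

namespace EdgeGraph

section Potential

variable {V : Type*} {G : EdgeGraph V}

lemma degree_eq_zero_iff {x : V} : G.degree x = 0 ↔ ∀ y, G.mult x y = 0 := by
  simp [degree, ENNReal.tsum_eq_zero]

lemma one_le_degree {x : V} (h : G.degree x ≠ 0) : 1 ≤ G.degree x := by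
  rw [Ne, degree_eq_zero_iff] at h
  push Not at h
  obtain ⟨y, hy⟩ := h
  refine le_trans ?_ (ENNReal.le_tsum y)
  exact_mod_cast Nat.one_le_iff_ne_zero.2 hy

lemma tsum_transition_le_one (x : V) : ∑' y, G.transition x y ≤ 1 := by
  simp only [transition, div_eq_mul_inv]
  rw [ENNReal.tsum_mul_right]
  exact ENNReal.mul_inv_le_one _

lemma average_nonneg {f : V → ℝ} (hf : ∀ x, 0 ≤ f x) (x : V) : 0 ≤ G.average f x :=
  div_nonneg (tsum_nonneg fun y => mul_nonneg (Nat.cast_nonneg _) (hf y))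
    (tsum_nonneg fun _ => Nat.cast_nonneg _)

lemma iterate_average_nonneg {f : V → ℝ} (hf : ∀ x, 0 ≤ f x) (n : ℕ) (x : V) :
    0 ≤ G.average^[n] f x := by
  induction n generalizing x with
  | zero => exact hf x
  | succ n ih => rw [Function.iterate_succ_apply']; exact average_nonneg ih x

lemma chebyshev_zero_nonneg (o x : V) : 0 ≤ G.chebyshev o 0 x := by
  by_cases h : x = o
  · subst h; simp [chebyshev]
  · simp [chebyshev, h]

lemma LocallyFinite.degree_eq (hG : G.LocallyFinite) (x : V) :
    G.degree x = ENNReal.ofReal (G.realDegree x) := by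
  rw [degree, realDegree, ENNReal.ofReal_tsum_of_nonneg (fun _ => Nat.cast_nonneg _)
    (hG.summable_mult x)]
  simp

lemma LocallyFinite.tsum_transition_mul_ofReal (hG : G.LocallyFinite) {f : V → ℝ}
    (hf : ∀ x, 0 ≤ f x) (x : V) :
    ∑' y, G.transition x y * ENNReal.ofReal (f y) = ENNReal.ofReal (G.average f x) := by
  by_cases h : G.realDegree x = 0
  · have h1 := hG.realDegree_eq_zero h
    simp [transition, average, h1]
  have hpos : 0 < G.realDegree x :=
    lt_of_le_of_ne (tsum_nonneg fun y => Nat.cast_nonneg _) (Ne.symm h)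
  rw [average, ENNReal.ofReal_div_of_pos hpos,
    ENNReal.ofReal_tsum_of_nonneg (fun y => mul_nonneg (Nat.cast_nonneg _) (hf y))
    (hG.summable_mult_mul x f), ← hG.degree_eq, div_eq_mul_inv, ← ENNReal.tsum_mul_right]
  refine tsum_congr fun y => ?_
  rw [ENNReal.ofReal_mul (Nat.cast_nonneg _), transition, div_eq_mul_inv, ENNReal.ofReal_natCast]
  ring

/-- The probability that the walk from `x` is at `o` after `n` steps. -/
noncomputable def stepProb (G : EdgeGraph V) (o : V) (n : ℕ) (x : V) : ℝ≥0∞ :=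
  ENNReal.ofReal (G.average^[n] (G.chebyshev o 0) x)

/-- The expected number of visits to `o` of the walk from `x`. -/
noncomputable def green (G : EdgeGraph V) (o x : V) : ℝ≥0∞ := ∑' n, G.stepProb o n x

/-- The Green function with pole `o`, truncated at `1`. -/
noncomputable def potential (G : EdgeGraph V) (o x : V) : ℝ := (min 1 (G.green o x)).toReal

lemma ofReal_potential (o x : V) :
    ENNReal.ofReal (G.potential o x) = min 1 (G.green o x) :=
  ENNReal.ofReal_toReal (ne_top_of_le_ne_top ENNReal.one_ne_top (min_le_left _ _))

lemma potential_nonneg (o x : V) : 0 ≤ G.potential o x := ENNReal.toReal_nonneg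

lemma potential_self (o : V) : G.potential o o = 1 := by
  have h : 1 ≤ G.green o o := by
    refine le_trans ?_ (ENNReal.le_tsum 0)
    simp [stepProb, chebyshev]
  simp [potential, h]

lemma LocallyFinite.stepProb_succ (hG : G.LocallyFinite) (o : V) (n : ℕ) (x : V) :
    G.stepProb o (n + 1) x = ∑' y, G.transition x y * G.stepProb o n y := by
  simp only [stepProb]
  rw [hG.tsum_transition_mul_ofReal fun y => iterate_average_nonneg (chebyshev_zero_nonneg o) n y,
    Function.iterate_succ_apply']

/-- A minimum of two superharmonic functions is superharmonic: averaging the Green function merely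
drops its term at time zero. The truncation keeps h finite without any transience assumption. -/
lemma LocallyFinite.average_potential_le (hG : G.LocallyFinite) (o x : V) :
    G.average (G.potential o) x ≤ G.potential o x := by
  rw [← ENNReal.ofReal_le_ofReal_iff (potential_nonneg o x),
    ← hG.tsum_transition_mul_ofReal (potential_nonneg o), ofReal_potential]
  simp only [ofReal_potential]
  refine le_min ?_ ?_
  · refine le_trans (ENNReal.tsum_le_tsum fun y => ?_) (tsum_transition_le_one (G := G) x)
    exact mul_le_of_le_one_right' (min_le_left _ _)
  · calc _ ≤ ∑' y, G.transition x y * G.green o y :=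
          ENNReal.tsum_le_tsum fun y => mul_le_mul_right (min_le_right _ _) _
      _ = ∑' n, G.stepProb o (n + 1) x := by
          simp only [green, ← ENNReal.tsum_mul_left, hG.stepProb_succ]
          exact ENNReal.tsum_comm
      _ ≤ G.green o x := by
          rw [green, tsum_eq_zero_add' (f := fun n => G.stepProb o n x) ENNReal.summable]
          exact le_add_self

/-- A Harnack inequality: a single neighbour contributes at most the whole sum over edges, which is
the degree times an average bounded by the value at x. -/
lemma potential_le_mul {D : ℕ} (hD : ∀ v, G.degree v ≤ D) (o : V) {x y : V}
    (h : G.mult x y ≠ 0) : G.potential o y ≤ D * G.potential o x := by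
  have hG := locallyFinite_of_degree_le hD
  have h1 : (G.mult x y : ℝ) * G.potential o y ≤ ∑' z, (G.mult x z : ℝ) * G.potential o z :=
    (hG.summable_mult_mul x _).le_tsum y fun z _ =>
      mul_nonneg (Nat.cast_nonneg _) (potential_nonneg o z)
  rw [← hG.realDegree_mul_average] at h1
  have h2 : (1 : ℝ) ≤ G.mult x y := by exact_mod_cast Nat.one_le_iff_ne_zero.2 h
  have h3 : G.realDegree x ≤ D := by
    have := hD x
    rw [hG.degree_eq] at this
    exact (ENNReal.ofReal_le_natCast).1 this
  have h4 : 0 ≤ G.realDegree x := tsum_nonneg fun y => Nat.cast_nonneg _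
  nlinarith [potential_nonneg (G := G) o y, potential_nonneg (G := G) o x,
    hG.average_potential_le o x, mul_le_mul_of_nonneg_left (hG.average_potential_le o x) h4,
    mul_le_mul_of_nonneg_right h3 (potential_nonneg (G := G) o x)]

end Potential

/-! ### Exponential decay of the Green function along the walk -/

section Decay

variable {V : Type*} [Countable V] [MeasurableSpace V] [DiscreteMeasurableSpace V]
  {G : EdgeGraph V} {Ω : Type*} [MeasurableSpace Ω] {ν : Measure Ω} {X : ℕ → Ω → V}

lemma IsRandomWalk.measure_inter_succ (hX : G.IsRandomWalk ν X) (n : ℕ) (x y : V) :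
    ν ({ω | X n ω = x} ∩ {ω | X (n + 1) ω = y}) = ν {ω | X n ω = x} * G.transition x y := by
  classical
  have h := hX.setLIntegral_succ n y (F := fun z => if z n = x then 1 else 0)
    (fun z z' h => by simp only [h n (Set.mem_Iic.2 le_rfl)])
  have hm : MeasurableSet {ω | X n ω = x} := hX.measurable n (measurableSet_singleton x)
  rw [← Measure.restrict_apply hm, ← lintegral_indicator_one hm, mul_comm,
    ← lintegral_indicator_const hm]
  convert h using 2
  · ext ω
    simp [Set.indicator_apply]
  · ext ω
    by_cases hω : X n ω = x <;> simp [hω]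

lemma IsRandomWalk.measure_succ (hX : G.IsRandomWalk ν X) (n : ℕ) (y : V) :
    ν {ω | X (n + 1) ω = y} = ∑' x, ν {ω | X n ω = x} * G.transition x y := by
  have hm : ∀ x, MeasurableSet {ω | X n ω = x} := fun x =>
    hX.measurable n (measurableSet_singleton x)
  have hy : MeasurableSet {ω | X (n + 1) ω = y} :=
    hX.measurable (n + 1) (measurableSet_singleton y)
  simp only [← hX.measure_inter_succ]
  rw [← lintegral_indicator_one hy, lintegral_eq_tsum_fibres ν (hX.measurable n)]
  refine tsum_congr fun x => ?_
  rw [lintegral_indicator_one hy, Measure.restrict_apply hy, Set.inter_comm]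

lemma IsRandomWalk.ae_mult_ne_zero (hX : G.IsRandomWalk ν X) :
    ∀ᵐ ω ∂ν, ∀ n, G.mult (X n ω) (X (n + 1) ω) ≠ 0 := by
  rw [ae_all_iff]
  intro n
  have h : ∀ p : V × V, G.mult p.1 p.2 = 0 →
      ν ({ω | X n ω = p.1} ∩ {ω | X (n + 1) ω = p.2}) = 0 := by
    intro p hp
    rw [hX.measure_inter_succ]
    simp [transition, hp]
  rw [ae_iff]
  refine measure_mono_null (t := ⋃ p : V × V, ⋃ _ : G.mult p.1 p.2 = 0,
    ({ω | X n ω = p.1} ∩ {ω | X (n + 1) ω = p.2})) (fun ω hω => ?_)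
    (measure_iUnion_null fun p => measure_iUnion_null (h p))
  simp only [Set.mem_ofPred_eq, not_not] at hω
  exact Set.mem_iUnion₂.2 ⟨(X n ω, X (n + 1) ω), hω, rfl, rfl⟩

/-- Reversibility with respect to the degree. It turns the law of the walk from `o` into `stepProb`,
which concerns the walk from x to `o`. The total mass appears because ν will be an unnormalised
restriction of the original measure. -/
lemma IsRandomWalk.measure_mul_degree {D : ℕ} (hD : ∀ v, G.degree v ≤ D)
    (hX : G.IsRandomWalk ν X) {o : V} (h0 : ∀ᵐ ω ∂ν, X 0 ω = o) (n : ℕ) : ∀ x,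
    ν {ω | X n ω = x} * G.degree o = ν Set.univ * (G.degree x * G.stepProb o n x) := by
  have hG := locallyFinite_of_degree_le hD
  induction n with
  | zero =>
    intro x
    by_cases hx : x = o
    · subst hx
      have : ν {ω | X 0 ω = x} = ν Set.univ :=
        measure_congr (by filter_upwards [h0] with ω hω; exact propext ⟨fun _ => trivial, fun _ => hω⟩)
      simp [this, stepProb, chebyshev]
    · have : ν {ω | X 0 ω = x} = 0 := by
        refine measure_mono_null (fun ω hω => ?_) h0
        intro h
        exact hx ((Eq.symm hω).trans h)
      simp [this, stepProb, chebyshev, hx]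
  | succ n ih =>
    intro y
    rw [hX.measure_succ, ← ENNReal.tsum_mul_right, hG.stepProb_succ, ← ENNReal.tsum_mul_left,
      ← ENNReal.tsum_mul_left]
    refine tsum_congr fun x => ?_
    have hcancel : ∀ u v, G.degree u * G.transition u v = G.mult u v := by
      intro u v
      by_cases hu : G.degree u = 0
      · simp [hu, degree_eq_zero_iff.1 hu v]
      · exact ENNReal.mul_div_cancel hu ((hD u).trans_lt (by simp)).ne
    calc _ = (ν {ω | X n ω = x} * G.degree o) * G.transition x y := by ring
      _ = ν Set.univ * ((G.degree x * G.transition x y) * G.stepProb o n x) := by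
        rw [ih x]; ring
      _ = ν Set.univ * ((G.degree y * G.transition y x) * G.stepProb o n x) := by
        rw [hcancel, hcancel, G.symm]
      _ = _ := by ring

lemma IsRandomWalk.degree_ne_zero (hX : G.IsRandomWalk ν X) (n : ℕ) {x : V}
    (hx : ν {ω | X n ω = x} ≠ 0) : G.degree x ≠ 0 := by
  intro h
  have h1 : ∀ y, ν ({ω | X n ω = x} ∩ {ω | X (n + 1) ω = y}) = 0 := by
    intro y
    rw [hX.measure_inter_succ]
    simp [transition, degree_eq_zero_iff.1 h y]
  refine hx (measure_mono_null (fun ω hω => ?_) (measure_iUnion_null h1))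
  exact Set.mem_iUnion.2 ⟨X (n + 1) ω, hω, rfl⟩

lemma IsRandomWalk.degree_start_ne_zero [NeZero ν] (hX : G.IsRandomWalk ν X) {o : V}
    (h0 : ∀ᵐ ω ∂ν, X 0 ω = o) : G.degree o ≠ 0 := by
  refine hX.degree_ne_zero 0 (x := o) fun h => ?_
  have h' : ∀ᵐ ω ∂ν, X 0 ω ≠ o := by
    rw [ae_iff]
    simpa using h
  obtain ⟨ω, h1, h2⟩ := (h0.and h').exists
  exact h2 h1

/-- At most `k * n + 1` times `m` are such that the walk is at distance at most `n` from `o` at time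
`m` and moves away from `o` at speed at least `1 / k` after time `m`. -/
lemma tsum_indicator_escape_le (r : ℕ → ℕ∞) (k n : ℕ) :
    ∑' m, Set.indicator {m | r m ≤ n ∧ ∀ j : ℕ, (j : ℕ∞) ≤ k * r (m + j)} (1 : ℕ → ℝ≥0∞) m ≤
      (k * n + 1 : ℕ) := by
  classical
  set M := {m | r m ≤ n ∧ ∀ j : ℕ, (j : ℕ∞) ≤ k * r (m + j)}
  rcases M.eq_empty_or_nonempty with h | h
  · simp [h]
  -- Any other element m of `M` lies within the escape started at `m₀`, so m − m₀ ≤ k · r m ≤ k · n.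
  set m₀ := sInf M
  have hsub : M ⊆ (Finset.Icc m₀ (m₀ + k * n) : Finset ℕ) := by
    intro m hm
    have h1 : m₀ ≤ m := Nat.sInf_le hm
    have h2 := (Nat.sInf_mem h).2 (m - m₀)
    have h3 : ((m - m₀ : ℕ) : ℕ∞) ≤ k * n := by
      refine h2.trans ?_
      rw [show sInf M + (m - m₀) = m by omega]
      exact mul_le_mul_right hm.1 _
    have h4 : m - m₀ ≤ k * n := by exact_mod_cast h3
    simp only [Finset.coe_Icc, Set.mem_Icc]
    omega
  calc _ ≤ ∑' m, Set.indicator (Finset.Icc m₀ (m₀ + k * n) : Finset ℕ) (1 : ℕ → ℝ≥0∞) m :=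
        ENNReal.tsum_le_tsum fun m => Set.indicator_le_indicator_of_subset hsub (by simp) m
    _ = _ := by
        rw [← tsum_subtype, Finset.tsum_subtype' _ (1 : ℕ → ℝ≥0∞)]
        simp only [Pi.one_apply, Finset.sum_const, Nat.card_Icc, nsmul_eq_mul, mul_one]
        congr 1
        omega

omit [Countable V] [MeasurableSpace V] [DiscreteMeasurableSpace V] in
lemma edist_le_of_stepProb_ne_zero {o : V} {n : ℕ} {x : V} (h : G.stepProb o n x ≠ 0) :
    G.toSimpleGraph.edist o x ≤ n := by
  have h' : G.average^[n] (G.chebyshev o 0) x ≠ 0 := fun h0 => h (by simp [stepProb, h0])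
  clear h
  induction n generalizing x with
  | zero => exact chebyshev_support o 0 x h'
  | succ n ih =>
    rw [Function.iterate_succ_apply'] at h'
    obtain ⟨y, h1, h2⟩ := exists_of_average_ne_zero h'
    refine (edist_le_of_mult_ne_zero o h1).trans ?_
    push_cast
    exact add_le_add (ih h2) le_rfl

lemma IsRandomWalk.stepProb_ne_zero [NeZero ν] {D : ℕ}
    (hD : ∀ v, G.degree v ≤ D) (hX : G.IsRandomWalk ν X) {o : V} (h0 : ∀ᵐ ω ∂ν, X 0 ω = o)
    {n : ℕ} {x : V} (hx : ν {ω | X n ω = x} ≠ 0) : G.stepProb o n x ≠ 0 := by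
  intro h
  have := hX.measure_mul_degree hD h0 n x
  rw [h, mul_zero, mul_zero, mul_eq_zero] at this
  exact this.elim hx (hX.degree_start_ne_zero h0)

lemma IsRandomWalk.measure_le_stepProb [NeZero ν] {D : ℕ}
    (hD : ∀ v, G.degree v ≤ D) (hX : G.IsRandomWalk ν X) {o : V} (h0 : ∀ᵐ ω ∂ν, X 0 ω = o)
    (n : ℕ) (x : V) : ν {ω | X n ω = x} ≤ ν Set.univ * (D * G.stepProb o n x) := by
  calc _ ≤ ν {ω | X n ω = x} * G.degree o :=
        le_mul_of_one_le_right' (one_le_degree (hX.degree_start_ne_zero h0))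
    _ = ν Set.univ * (G.degree x * G.stepProb o n x) := hX.measure_mul_degree hD h0 n x
    _ ≤ _ := mul_le_mul_right (mul_le_mul_left (hD x) _) _

lemma IsRandomWalk.stepProb_le_measure [NeZero ν] {D : ℕ}
    (hD : ∀ v, G.degree v ≤ D) (hX : G.IsRandomWalk ν X) {o : V} (h0 : ∀ᵐ ω ∂ν, X 0 ω = o)
    (n : ℕ) (x : V) : ν Set.univ * G.stepProb o n x ≤ D * ν {ω | X n ω = x} := by
  by_cases hx : G.degree x = 0
  · have : G.stepProb o n x = 0 := by
      rcases n with _ | n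
      · have hne : x ≠ o := by
          rintro rfl
          exact hX.degree_start_ne_zero h0 hx
        simp [stepProb, chebyshev, hne]
      · rw [(locallyFinite_of_degree_le hD).stepProb_succ]
        simp [transition, degree_eq_zero_iff.1 hx]
    simp [this]
  calc _ ≤ ν Set.univ * (G.degree x * G.stepProb o n x) :=
        mul_le_mul_right (le_mul_of_one_le_left' (one_le_degree hx)) _
    _ = ν {ω | X n ω = x} * G.degree o := (hX.measure_mul_degree hD h0 n x).symm
    _ ≤ _ := by rw [mul_comm]; exact mul_le_mul_left (hD o) _

/-- The probability, started from `x`, that the walk moves away from `o` at speed at least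
`1 / k`. -/
noncomputable def escapeProb (G : EdgeGraph V) (o : V) (k : ℕ) (x : V) : ℝ≥0∞ :=
  ⨅ l, G.stayProb l (fun j => {y | (j : ℕ∞) ≤ k * G.toSimpleGraph.edist o y}) x

lemma IsRandomWalk.measure_escape [IsFiniteMeasure ν] (hX : G.IsRandomWalk ν X) (o : V)
    (k m : ℕ) (x : V) :
    ν {ω | X m ω = x ∧ ∀ j : ℕ, (j : ℕ∞) ≤ k * G.toSimpleGraph.edist o (X (m + j) ω)} =
      ν {ω | X m ω = x} * G.escapeProb o k x :=
  hX.measure_stay_forever m x fun j => {y | (j : ℕ∞) ≤ k * G.toSimpleGraph.edist o y}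

omit [Countable V] in
lemma IsRandomWalk.measurableSet_escape (hX : G.IsRandomWalk ν X) (o : V) (k m : ℕ) :
    MeasurableSet {ω | ∀ j : ℕ, (j : ℕ∞) ≤ k * G.toSimpleGraph.edist o (X (m + j) ω)} := by
  have : {ω | ∀ j : ℕ, (j : ℕ∞) ≤ k * G.toSimpleGraph.edist o (X (m + j) ω)} =
      ⋂ j : ℕ, X (m + j) ⁻¹' {y | (j : ℕ∞) ≤ k * G.toSimpleGraph.edist o y} := by
    ext ω; simp
  rw [this]
  exact MeasurableSet.iInter fun j => hX.measurable _ MeasurableSet.of_discrete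

-- Reversibility and the Markov property at time m bound the sum by D times the expected number of
-- times m at which the walk is within distance n of `o` and starts an escape; pathwise there are at
-- most kn + 1 of them.
open Classical in
lemma IsRandomWalk.tsum_green_mul_escapeProb_le [IsFiniteMeasure ν] [NeZero ν] {D : ℕ}
    (hD : ∀ v, G.degree v ≤ D) (hX : G.IsRandomWalk ν X) {o : V} (h0 : ∀ᵐ ω ∂ν, X 0 ω = o)
    (k n : ℕ) :
    ∑' x, (if G.toSimpleGraph.edist o x ≤ n then G.green o x * G.escapeProb o k x else 0) ≤
      D * (k * n + 1 : ℕ) := by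
  have hν : ν Set.univ ≠ 0 := by simp [NeZero.ne ν]
  rw [← ENNReal.mul_le_mul_iff_right hν (measure_ne_top ν _)]
  set R : ℕ → Ω → Prop := fun m ω => G.toSimpleGraph.edist o (X m ω) ≤ n ∧
    ∀ j : ℕ, (j : ℕ∞) ≤ k * G.toSimpleGraph.edist o (X (m + j) ω)
  have hR : ∀ m, MeasurableSet {ω | R m ω} := fun m =>
    (hX.measurable m (MeasurableSet.of_discrete
      (s := {x | G.toSimpleGraph.edist o x ≤ n}))).inter (hX.measurableSet_escape o k m)
  have hfib : ∀ m, ∑' x, (if G.toSimpleGraph.edist o x ≤ n then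
      ν {ω | X m ω = x} * G.escapeProb o k x else 0) = ν {ω | R m ω} := by
    intro m
    rw [← lintegral_indicator_one (hR m), lintegral_eq_tsum_fibres ν (hX.measurable m)]
    refine tsum_congr fun x => ?_
    rw [lintegral_indicator_one (hR m), Measure.restrict_apply (hR m)]
    by_cases hx : G.toSimpleGraph.edist o x ≤ n
    · rw [if_pos hx, ← hX.measure_escape]
      congr 1
      ext ω
      simp only [R, Set.mem_ofPred_eq, Set.mem_inter_iff]
      constructor
      · rintro ⟨rfl, h⟩; exact ⟨⟨hx, h⟩, rfl⟩
      · rintro ⟨⟨_, h⟩, rfl⟩; exact ⟨rfl, h⟩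
    · rw [if_neg hx]
      symm
      convert measure_empty (μ := ν)
      ext ω
      simp only [R, Set.mem_ofPred_eq, Set.mem_inter_iff, Set.mem_empty_iff_false, iff_false]
      rintro ⟨⟨h, _⟩, rfl⟩
      exact hx h
  calc _ = ∑' x, (if G.toSimpleGraph.edist o x ≤ n then
          ∑' m, (ν Set.univ * G.stepProb o m x) * G.escapeProb o k x else 0) := by
        rw [← ENNReal.tsum_mul_left]
        refine tsum_congr fun x => ?_
        split_ifs
        · rw [ENNReal.tsum_mul_right, ENNReal.tsum_mul_left, green]; ring
        · simp
    _ ≤ ∑' x, ∑' m, D * (if G.toSimpleGraph.edist o x ≤ n then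
          ν {ω | X m ω = x} * G.escapeProb o k x else 0) := by
        refine ENNReal.tsum_le_tsum fun x => ?_
        split_ifs
        · refine ENNReal.tsum_le_tsum fun m => ?_
          rw [← mul_assoc]
          exact mul_le_mul_left (hX.stepProb_le_measure hD h0 m x) _
        · simp
    _ = D * ∑' m, ν {ω | R m ω} := by
        rw [ENNReal.tsum_comm, ← ENNReal.tsum_mul_left]
        simp only [ENNReal.tsum_mul_left, hfib]
    _ = D * ∫⁻ ω, ∑' m, Set.indicator {m | R m ω} (1 : ℕ → ℝ≥0∞) m ∂ν := by
        rw [lintegral_tsum]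
        · congr 2
          ext m
          rw [← lintegral_indicator_one (hR m)]
          rfl
        · exact fun m => (measurable_one.indicator (hR m)).aemeasurable
    _ ≤ D * ∫⁻ _, (k * n + 1 : ℕ) ∂ν := by
        refine mul_le_mul_right (lintegral_mono fun ω => ?_) _
        exact tsum_indicator_escape_le (fun m => G.toSimpleGraph.edist o (X m ω)) k n
    _ = _ := by rw [lintegral_const]; ring

-- With l = 1/(4k), d = n/k and cosh u ≤ exp(u²/2), the Carne–Varopoulos bound has exponent −n/(4k²)
-- + n/(8k²) = −n/(8k²). Writing the result as β^n · β^n leaves one factor to be traded for h(x) ≥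
-- β^n and the other for summability.
omit [Countable V] [MeasurableSpace V] [DiscreteMeasurableSpace V] in
lemma exists_stepProb_le {D : ℕ} (hD : ∀ v, G.degree v ≤ D) (o : V) {k : ℕ}
    (hk : 0 < k) : ∃ β : ℝ, 0 < β ∧ β < 1 ∧ ∃ K : ℝ, 0 ≤ K ∧ ∀ (x : V) (n : ℕ),
      G.degree x ≠ 0 → (n : ℕ∞) ≤ k * G.toSimpleGraph.edist o x →
      G.stepProb o n x ≤ ENNReal.ofReal (K * (β ^ n * β ^ n)) := by
  have hk' : (0 : ℝ) < k := by exact_mod_cast hk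
  obtain ⟨K, hK, h⟩ := (locallyFinite_of_degree_le hD).exists_iterate_average_le o
    (l := 1 / (4 * k)) (by positivity)
  refine ⟨Real.exp (-(1 / (16 * k ^ 2))), Real.exp_pos _, ?_, K, hK, fun x n hx hn => ?_⟩
  · rw [Real.exp_lt_one_iff]
    simp only [Left.neg_neg_iff]
    positivity
  refine ENNReal.ofReal_le_ofReal ((le_abs_self _).trans ?_)
  have hx' : ∃ y, G.mult x y ≠ 0 := by
    by_contra! H
    exact hx (degree_eq_zero_iff.2 H)
  refine (h x (n / k) hx' (fun j hj => ?_) n).trans ?_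
  · rw [div_le_iff₀ hk', mul_comm]
    have : (n : ℕ∞) ≤ k * j := hn.trans (mul_le_mul_right hj _)
    exact_mod_cast this
  · rw [mul_assoc]
    refine mul_le_mul_of_nonneg_left ?_ hK
    have h1 := pow_le_pow_left₀ (Real.cosh_pos _).le
      (Real.cosh_le_exp_half_sq (2 * (1 / (4 * (k : ℝ))))) n
    refine (mul_le_mul_of_nonneg_left h1 (Real.exp_pos _).le).trans (le_of_eq ?_)
    rw [← Real.exp_nat_mul, ← Real.exp_nat_mul, ← Real.exp_add, ← Real.exp_add]
    congr 1
    field_simp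
    ring

/-- On the event that the walk has speed at least `1 / k`, the truncated Green function decays
exponentially along the walk. -/
lemma IsRandomWalk.eventually_potential_lt [IsFiniteMeasure ν] [NeZero ν] {D : ℕ}
    (hD : ∀ v, G.degree v ≤ D) (hX : G.IsRandomWalk ν X) {o : V} (h0 : ∀ᵐ ω ∂ν, X 0 ω = o)
    {k : ℕ} (hk : 0 < k) : ∃ β : ℝ, 0 < β ∧ β < 1 ∧ ∀ N : ℕ, ∀ᵐ ω ∂ν,
      (∀ i ≥ N, (i : ℕ∞) ≤ k * G.toSimpleGraph.edist o (X i ω)) →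
      ∀ᶠ n in atTop, G.potential o (X n ω) < β ^ n := by
  classical
  obtain ⟨β, hβ0, hβ1, K, hK, hstep⟩ := exists_stepProb_le hD o hk
  refine ⟨β, hβ0, hβ1, fun N => ?_⟩
  -- The last condition involves only the walk from time n on, and not `N`, so the Markov property
  -- at time n applies to it.
  set B : ℕ → Set Ω := fun n => {ω | β ^ n ≤ G.potential o (X n ω) ∧
    (n : ℕ∞) ≤ k * G.toSimpleGraph.edist o (X n ω) ∧
    ∀ j : ℕ, (j : ℕ∞) ≤ k * G.toSimpleGraph.edist o (X (n + j) ω)}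
  have hB : ∀ n, ν (B n) ≤
      ν Set.univ * D * D * ENNReal.ofReal (K * β ^ n * (k * n + 1 : ℕ)) := by
    intro n
    have hfib : ∀ x, ν (B n ∩ {ω | X n ω = x}) ≤ ν Set.univ * D * ENNReal.ofReal (K * β ^ n) *
        (if G.toSimpleGraph.edist o x ≤ n then G.green o x * G.escapeProb o k x else 0) := by
      intro x
      by_cases hx : ν {ω | X n ω = x} = 0
      · rw [measure_mono_null Set.inter_subset_right hx]
        exact zero_le
      rw [if_pos (edist_le_of_stepProb_ne_zero (hX.stepProb_ne_zero hD h0 hx))]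
      by_cases hx' : β ^ n ≤ G.potential o x ∧ (n : ℕ∞) ≤ k * G.toSimpleGraph.edist o x
      · have h1 : ν (B n ∩ {ω | X n ω = x}) ≤ ν {ω | X n ω = x} * G.escapeProb o k x := by
          rw [← hX.measure_escape]
          refine measure_mono ?_
          rintro ω ⟨⟨_, _, h⟩, hω⟩
          exact ⟨hω, h⟩
        have h2 : ENNReal.ofReal (K * (β ^ n * β ^ n)) ≤
            ENNReal.ofReal (K * β ^ n) * G.green o x := by
          rw [← mul_assoc, ENNReal.ofReal_mul (by positivity)]
          refine mul_le_mul_right ?_ _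
          refine (ENNReal.ofReal_le_ofReal hx'.1).trans ?_
          rw [ofReal_potential]
          exact min_le_right _ _
        calc _ ≤ ν {ω | X n ω = x} * G.escapeProb o k x := h1
          _ ≤ (ν Set.univ * (D * (ENNReal.ofReal (K * β ^ n) * G.green o x))) *
              G.escapeProb o k x := by
            refine mul_le_mul_left ((hX.measure_le_stepProb hD h0 n x).trans ?_) _
            exact mul_le_mul_right (mul_le_mul_right
              ((hstep x n (hX.degree_ne_zero n hx) hx'.2).trans h2) _) _
          _ = _ := by ring
      · have : B n ∩ {ω | X n ω = x} = ∅ := by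
          ext ω
          simp only [Set.mem_inter_iff, Set.mem_ofPred_eq, Set.mem_empty_iff_false, iff_false, B]
          rintro ⟨⟨ha, hb, _⟩, rfl⟩
          exact hx' ⟨ha, hb⟩
        rw [this, measure_empty]
        exact zero_le
    calc ν (B n) ≤ ∑' x, ν (B n ∩ {ω | X n ω = x}) := by
          refine (measure_mono fun ω hω => ?_).trans (measure_iUnion_le _)
          exact Set.mem_iUnion.2 ⟨X n ω, hω, rfl⟩
      _ ≤ ν Set.univ * D * ENNReal.ofReal (K * β ^ n) * (D * (k * n + 1 : ℕ)) := by
          refine (ENNReal.tsum_le_tsum hfib).trans ?_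
          rw [ENNReal.tsum_mul_left]
          exact mul_le_mul_right (hX.tsum_green_mul_escapeProb_le hD h0 k n) _
      _ = _ := by
          rw [ENNReal.ofReal_mul (p := K * β ^ n) (by positivity), ENNReal.ofReal_natCast]
          ring
  have hsum : Summable fun n : ℕ => K * β ^ n * (k * n + 1 : ℕ) := by
    have hβ : ‖β‖ < 1 := by rwa [Real.norm_eq_abs, abs_of_pos hβ0]
    have h1 := summable_pow_mul_geometric_of_norm_lt_one 1 hβ
    have h2 := summable_pow_mul_geometric_of_norm_lt_one 0 hβ
    refine ((h1.mul_left (K * k)).add (h2.mul_left K)).congr fun n => ?_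
    push_cast
    ring
  have htsum : ∑' n, ν (B n) ≠ ∞ := by
    refine ne_top_of_le_ne_top ?_ (ENNReal.tsum_le_tsum hB)
    rw [ENNReal.tsum_mul_left, ← ENNReal.ofReal_tsum_of_nonneg (fun n => by positivity) hsum]
    exact ENNReal.mul_ne_top (ENNReal.mul_ne_top (ENNReal.mul_ne_top (measure_ne_top _ _)
      (ENNReal.natCast_ne_top _)) (ENNReal.natCast_ne_top _)) ENNReal.ofReal_ne_top
  filter_upwards [ae_eventually_notMem htsum] with ω hω hE
  filter_upwards [hω, eventually_ge_atTop N] with n hn hnN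
  by_contra hcon
  -- On the speed event the escape condition is automatic, since j ≤ n + j.
  refine hn ⟨not_lt.1 hcon, hE n hnN, fun j => le_trans ?_ (hE (n + j) (by omega))⟩
  exact_mod_cast Nat.le_add_left j n

end Decay

end EdgeGraph

/-! ### Levels crossed by a positive sequence, and their scores -/

/-- The history of a sequence of real numbers relative to a level: so far it has not gone below the
level, or it went below the level and this first descent was too small, or this first
descent was large and it has, or has not, come back to the level since. -/
inductive LevelState
  | fresh
  | missed
  | alive
  | killed

namespace LevelState

open Classical in
/-- The change of state caused by a new value `v`. -/
noncomputable def step (a η v : ℝ) : LevelState → LevelState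
  | fresh => if a ≤ v then fresh else if v ≤ η * a then alive else missed
  | alive => if a ≤ v then killed else alive
  | missed => missed
  | killed => killed

open Classical in
/-- The state of the level `a` at time `n` for the sequence `v`. -/
noncomputable def state (a η : ℝ) (v : ℕ → ℝ) : ℕ → LevelState
  | 0 => if a ≤ v 0 then fresh else missed
  | n + 1 => step a η (v (n + 1)) (state a η v n)

/-- The score of a level: it is a supermartingale along a supermartingale `v`. -/
noncomputable def score (a η v : ℝ) : LevelState → ℝ
  | fresh => 0
  | missed => 0
  | alive => v / a - η
  | killed => 1 - η

/-- The derivative of the score. -/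
noncomputable def slope (a : ℝ) : LevelState → ℝ
  | alive => 1 / a
  | _ => 0

variable {a η v v' : ℝ}

lemma slope_nonneg (ha : 0 < a) (s : LevelState) : 0 ≤ s.slope a := by
  cases s <;> simp [slope, ha.le]

/-- Becoming alive happens with v'/a ≤ η, hence with a nonpositive score, and being killed cuts v'/a
≥ 1 down to 1. Otherwise the score is affine in the value. The linear majorant makes the drift
nonpositive under a superharmonic function. -/
lemma score_step_sub_le (ha : 0 < a) (s : LevelState) :
    (s.step a η v').score a η v' - s.score a η v ≤ s.slope a * (v' - v) := by
  have e : 1 / a * (v' - v) = v' / a - v / a := by ring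
  cases s with
  | fresh =>
    simp only [step, slope]
    split_ifs with h1 h2
    · simp [score]
    · have : v' / a ≤ η := (div_le_iff₀ ha).2 h2
      simp only [score]
      linarith
    · simp [score]
  | alive =>
    simp only [step, slope, e]
    split_ifs with h1
    · have : 1 ≤ v' / a := (one_le_div ha).2 h1
      simp only [score]
      linarith
    · simp only [score]
      linarith
  | missed => simp [step, slope, score]
  | killed => simp [step, slope, score]

lemma state_congr {u w : ℕ → ℝ} {n : ℕ} (h : ∀ i ≤ n, u i = w i) :
    state a η u n = state a η w n := by
  induction n with
  | zero => simp [state, h 0 le_rfl]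
  | succ n ih => simp only [state, ih fun i hi => h i (by omega), h (n + 1) le_rfl]

lemma score_state_zero (w : ℕ → ℝ) : (state a η w 0).score a η (w 0) = 0 := by
  simp only [state]
  split_ifs <;> rfl

lemma le_of_state_eq_fresh {w : ℕ → ℝ} {n : ℕ} (h : state a η w n = fresh) :
    ∀ i ≤ n, a ≤ w i := by
  induction n with
  | zero =>
    intro i hi
    obtain rfl : i = 0 := by omega
    by_contra hc
    simp [state, hc] at h
  | succ n ih =>
    have hs : state a η w n = fresh ∧ a ≤ w (n + 1) := by
      simp only [state] at h
      generalize state a η w n = s at h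
      cases s <;> simp only [step] at h <;> (try split_ifs at h) <;> simp_all
    intro i hi
    rcases Nat.le_succ_iff.1 hi with hi | rfl
    · exact ih hs.1 i hi
    · exact hs.2

lemma exists_of_state_eq_alive {w : ℕ → ℝ} {n : ℕ} (h : state a η w n = alive) :
    ∃ i < n, (∀ j ≤ i, a ≤ w j) ∧ w (i + 1) ≤ η * a ∧ ∀ j, i < j → j ≤ n → w j < a := by
  induction n with
  | zero =>
    simp only [state] at h
    split_ifs at h
  | succ n ih =>
    have hs : (state a η w n = fresh ∧ w (n + 1) ≤ η * a ∧ w (n + 1) < a) ∨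
        (state a η w n = alive ∧ w (n + 1) < a) := by
      simp only [state] at h
      generalize state a η w n = s at h
      cases s <;> simp only [step] at h <;> (try split_ifs at h) <;> simp_all
    rcases hs with ⟨hs, h1, h2⟩ | ⟨hs, h1⟩
    · refine ⟨n, by omega, le_of_state_eq_fresh hs, h1, fun j hj hj' => ?_⟩
      obtain rfl : j = n + 1 := by omega
      exact h2
    · obtain ⟨i, hi, h2, h3, h4⟩ := ih hs
      refine ⟨i, by omega, h2, h3, fun j hj hj' => ?_⟩
      rcases Nat.le_succ_iff.1 hj' with hj' | rfl
      · exact h4 j hj hj'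
      · exact h1

lemma exists_of_state_eq_missed {w : ℕ → ℝ} (h0 : a ≤ w 0) {n : ℕ}
    (h : state a η w n = missed) : ∃ i < n, η * a < w (i + 1) ∧ w (i + 1) < a := by
  induction n with
  | zero => simp [state, h0] at h
  | succ n ih =>
    have hs : state a η w n = missed ∨ (η * a < w (n + 1) ∧ w (n + 1) < a) := by
      simp only [state] at h
      generalize state a η w n = s at h
      cases s <;> simp only [step] at h <;> (try split_ifs at h) <;> simp_all
    rcases hs with hs | hs
    · obtain ⟨i, hi, h1⟩ := ih hs
      exact ⟨i, by omega, h1⟩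
    · exact ⟨n, by omega, hs⟩

open Classical in
/-- The ratio, at most `1`, of two positive numbers. -/
noncomputable def ratio (a v : ℝ) : ℝ := if a ≤ v then a / v else v / a

/-- A fresh level changes its score only if the step jumps below a, which forces w n ≤ D·a. For an
alive level, w n < a and all terms are controlled by D·(w n / a). The other two states are frozen.
-/
lemma abs_score_step_sub_le (ha : 0 < a) (hη0 : 0 < η) (hη1 : η < 1) {D : ℝ} (hD : 1 ≤ D)
    {w : ℕ → ℝ} {n : ℕ} (hw : 0 ≤ w n) (hv : 0 ≤ v') (h1 : v' ≤ D * w n) (h2 : w n ≤ D * v') :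
    |((state a η w n).step a η v').score a η v' - (state a η w n).score a η (w n)| ≤
      D * ratio a (w n) := by
  have hr : 0 ≤ ratio a (w n) := by
    unfold ratio; split_ifs <;> positivity
  rcases hs : state a η w n with _ | _ | _ | _
  · have haw := le_of_state_eq_fresh hs n le_rfl
    have hw' : 0 < w n := ha.trans_le haw
    simp only [step, ratio, if_pos haw]
    split_ifs with h3 h4
    · simp only [score, sub_self, abs_zero]
      positivity
    · have h5 : v' / a ≤ η := (div_le_iff₀ ha).2 h4
      have h6 : 0 ≤ v' / a := by positivity
      have h7 : 1 ≤ D * (a / w n) := by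
        rw [← mul_div_assoc, one_le_div hw']
        refine h2.trans (mul_le_mul_of_nonneg_left ?_ (by linarith))
        linarith
      simp only [score, sub_zero]
      rw [abs_le]
      constructor <;> linarith
    · simp only [score, sub_self, abs_zero]
      positivity
  · simp only [step, score, sub_self, abs_zero]; positivity
  · obtain ⟨i, hi, -, -, h3⟩ := exists_of_state_eq_alive hs
    have hwa : w n < a := h3 n hi le_rfl
    have h4 : v' / a ≤ D * (w n / a) := by
      rw [← mul_div_assoc]; gcongr
    have h5 : 0 ≤ v' / a := by positivity
    have h6 : 0 ≤ w n / a := by positivity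
    have h7 : w n / a ≤ D * (w n / a) := le_mul_of_one_le_left h6 hD
    have h8 : w n / a < 1 := (div_lt_one ha).2 hwa
    simp only [step, ratio, if_neg (not_le.2 hwa)]
    split_ifs with h9
    · have : 1 ≤ v' / a := (one_le_div ha).2 h9
      simp only [score]
      rw [abs_le]
      constructor <;> linarith
    · simp only [score]
      rw [abs_le]
      constructor <;> linarith
  · simp only [step, score, sub_self, abs_zero]; positivity

lemma geom_sum_le (hη0 : 0 < η) (hη1 : η < 1) (n : ℕ) :
    ∑ i ∈ Finset.range n, η ^ i ≤ 1 / (1 - η) := by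
  rw [le_div_iff₀ (by linarith), mul_comm, mul_neg_geom_sum]
  linarith [pow_pos hη0 n]

/-- The levels above v and those at or below v each contribute at most a geometric series, so the
bound does not depend on the number of levels. -/
lemma sum_ratio_le (hη0 : 0 < η) (hη1 : η < 1) (hv : 0 ≤ v) (J : ℕ) :
    ∑ j ∈ Finset.range J, ratio (η ^ j) v ≤ 2 / (1 - η) := by
  have hη : 0 < 1 - η := by linarith
  rcases hv.eq_or_lt with rfl | hv
  · have : ∀ j, ratio (η ^ j) 0 = 0 := fun j => by
      simp [ratio, not_le.2 (pow_pos hη0 j)]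
    simp only [this, Finset.sum_const_zero]
    positivity
  classical
  have hex : ∃ j, η ^ j ≤ v := (exists_pow_lt_of_lt_one hv hη1).imp fun _ h => h.le
  set m := Nat.find hex
  have hm : η ^ m ≤ v := Nat.find_spec hex
  have hlt : ∀ j < m, v < η ^ j := fun j hj => not_le.1 (Nat.find_min hex hj)
  have hnn : ∀ j, 0 ≤ ratio (η ^ j) v := fun j => by
    unfold ratio; split_ifs <;> positivity
  calc _ ≤ ∑ j ∈ Finset.range (m + J), ratio (η ^ j) v :=
        Finset.sum_le_sum_of_subset_of_nonneg (Finset.range_mono (by omega)) fun j _ _ => hnn j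
    _ = ∑ j ∈ Finset.range m, ratio (η ^ (m - 1 - j)) v +
        ∑ i ∈ Finset.range J, ratio (η ^ (m + i)) v := by
      rw [Finset.sum_range_add, Finset.sum_range_reflect (fun j => ratio (η ^ j) v)]
    _ ≤ ∑ j ∈ Finset.range m, η ^ j + ∑ i ∈ Finset.range J, η ^ i := by
      refine add_le_add (Finset.sum_le_sum fun j hj => ?_) (Finset.sum_le_sum fun i _ => ?_)
      · have hj' := Finset.mem_range.1 hj
        rw [ratio, if_neg (not_le.2 (hlt _ (by omega))), div_le_iff₀ (by positivity), ← pow_add]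
        exact (hlt _ (by omega)).le
      · have : η ^ (m + i) ≤ v :=
          (pow_le_pow_of_le_one hη0.le hη1.le (Nat.le_add_right m i)).trans hm
        rw [ratio, if_pos this, div_le_iff₀ hv, pow_add, mul_comm]
        exact mul_le_mul_of_nonneg_left hm (by positivity)
    _ ≤ 1 / (1 - η) + 1 / (1 - η) := add_le_add (geom_sum_le hη0 hη1 m) (geom_sum_le hη0 hη1 J)
    _ = _ := by ring

/-- The total score of the first `J` levels of a geometric scale. -/
noncomputable def totalScore (η : ℝ) (J : ℕ) (w : ℕ → ℝ) (n : ℕ) : ℝ :=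
  ∑ j ∈ Finset.range J, (state (η ^ j) η w n).score (η ^ j) η (w n)

-- At time n none of the 2n levels is fresh, and at most n are missed. A killed level scores 1 − η
-- and an alive one at least −η, so a small total score leaves room for few killed levels. Using
-- twice as many levels as steps is what makes the count positive.
open Classical in
lemma le_card_alive (hη0 : 0 < η) (hη1 : η < 1) {w : ℕ → ℝ} {n : ℕ} (hw0 : 1 ≤ w 0)
    (hw : 0 ≤ w n) (hwn : w n < η ^ (2 * n))
    (hscore : totalScore η (2 * n) w n ≤ (1 - η) / 2 * n) :
    (1 - η) / 2 * n ≤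
      ((Finset.range (2 * n)).filter fun j => state (η ^ j) η w n = alive).card := by
  set A := (Finset.range (2 * n)).filter fun j => state (η ^ j) η w n = alive with hA
  set M := (Finset.range (2 * n)).filter fun j => state (η ^ j) η w n = missed with hM
  -- The intervals (η^(j+1), η^j) are disjoint, so distinct missed levels have distinct landing
  -- times among the n steps.
  have hM' : M.card ≤ n := by
    have h1 : ∀ j ∈ M, ∃ i < n, η ^ (j + 1) < w (i + 1) ∧ w (i + 1) < η ^ j := by
      intro j hj
      have := exists_of_state_eq_missed ((pow_le_one₀ hη0.le hη1.le).trans hw0)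
        (Finset.mem_filter.1 hj).2
      rwa [← pow_succ'] at this
    choose! t ht using h1
    have : M.card ≤ (Finset.range n).card := by
      refine Finset.card_le_card_of_injOn t (fun j hj => Finset.mem_coe.2
        (Finset.mem_range.2 (ht j hj).1)) ?_
      have key : ∀ j ∈ M, ∀ l ∈ M, t j = t l → ¬ j < l := by
        intro j hj l hl h hlt
        have h1 := (ht j hj).2.1
        have h2 := (ht l hl).2.2
        rw [h] at h1
        have h3 : η ^ l ≤ η ^ (j + 1) := pow_le_pow_of_le_one hη0.le hη1.le hlt
        linarith
      intro j hj l hl h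
      exact le_antisymm (not_lt.1 (key l hl j hj h.symm)) (not_lt.1 (key j hj l hl h))
    simpa using this
  have hterm : ∀ j ∈ Finset.range (2 * n),
      (1 - η) - (if state (η ^ j) η w n = missed then 1 - η else 0) -
        (if state (η ^ j) η w n = alive then 1 else 0) ≤
      (state (η ^ j) η w n).score (η ^ j) η (w n) := by
    intro j hj
    rcases hs : state (η ^ j) η w n with _ | _ | _ | _
    · have h1 := le_of_state_eq_fresh hs n le_rfl
      have h2 : η ^ (2 * n) ≤ η ^ j :=
        pow_le_pow_of_le_one hη0.le hη1.le (Finset.mem_range.1 hj).le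
      linarith
    · simp [score]
    · have : 0 ≤ w n / η ^ j := by positivity
      simp only [score, reduceCtorEq, if_false, if_true]
      linarith
    · simp [score]
  have hsum := Finset.sum_le_sum hterm
  rw [Finset.sum_sub_distrib, Finset.sum_sub_distrib, ← Finset.sum_filter, ← Finset.sum_filter,
    Finset.sum_const, Finset.sum_const, Finset.sum_const, ← hM, ← hA, Finset.card_range] at hsum
  simp only [nsmul_eq_mul, mul_one] at hsum
  have hM'' : (M.card : ℝ) ≤ n := by exact_mod_cast hM'
  have h3 : (M.card : ℝ) * (1 - η) ≤ n * (1 - η) := mul_le_mul_of_nonneg_right hM'' (by linarith)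
  rw [totalScore] at hscore
  push_cast at hsum
  linarith

end LevelState

-- An alive level has a passage time i ≤ n: h is at least the level up to i and below it from i + 1
-- on, through `hn` for times beyond n. Hence i is a cut time. If levels p ≤ j share it, then η^p ≤
-- D·η^(j+1), which limits j − p.
open LevelState in
open Classical in
lemma card_alive_le_mul_cutTimeCount {V : Type*} {η : ℝ} (hη0 : 0 < η)
    (hη1 : η < 1) {D : ℝ} (hD : 0 < D)
    {W : ℕ}     (hW : D * η ^ W < 1) {h : V → ℝ} {x : ℕ → V} (hx : ∀ i, h (x i) ≤ D * h (x (i + 1))) {n : ℕ}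
    (hn : ∀ i ≥ n, h (x i) < η ^ (2 * n)) :
    ((Finset.range (2 * n)).filter
      fun j => state (η ^ j) η (fun i => h (x i)) n = alive).card ≤ W * cutTimeCount x n := by
  set A := (Finset.range (2 * n)).filter fun j => state (η ^ j) η (fun i => h (x i)) n = alive
  have h1 : ∀ j ∈ A, ∃ i < n, (∀ l ≤ i, η ^ j ≤ h (x l)) ∧ h (x (i + 1)) ≤ η * η ^ j ∧
      ∀ l, i < l → l ≤ n → h (x l) < η ^ j :=
    fun j hj => exists_of_state_eq_alive (Finset.mem_filter.1 hj).2
  choose! t ht using h1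
  have hcut : ∀ j ∈ A, IsCutTime x (t j) := by
    intro j hj
    obtain ⟨-, h2, -, h3⟩ := ht j hj
    refine Set.disjoint_left.2 ?_
    rintro _ ⟨i, hi, rfl⟩ ⟨l, hl, hil⟩
    have h4 := h2 i hi
    rw [← hil] at h4
    rcases le_total l n with hln | hln
    · exact absurd (h3 l hl hln) (not_lt.2 h4)
    · have h5 := hn l hln
      have h6 : η ^ (2 * n) ≤ η ^ j := pow_le_pow_of_le_one hη0.le hη1.le
        (Finset.mem_range.1 (Finset.mem_filter.1 hj).1).le
      linarith
  have hfin : {m : ℕ | m ≤ n ∧ IsCutTime x m}.Finite :=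
    (Set.finite_Iic n).subset fun m hm => hm.1
  have himage : (A.image t).card ≤ cutTimeCount x n := by
    rw [cutTimeCount, ← Set.ncard_coe_finset]
    refine Set.ncard_le_ncard ?_ hfin
    intro m hm
    obtain ⟨j, hj, rfl⟩ := Finset.mem_image.1 (Finset.mem_coe.1 hm)
    exact ⟨(ht j hj).1.le, hcut j hj⟩
  refine (Finset.card_le_mul_card_image A W fun m _ => ?_).trans (Nat.mul_le_mul_left W himage)
  rcases (A.filter fun j => t j = m).eq_empty_or_nonempty with he | hne
  · simp [he]
  set p := (A.filter fun j => t j = m).min' hne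
  have hp := Finset.mem_filter.1 (Finset.min'_mem _ hne)
  have hsub : (A.filter fun j => t j = m) ⊆ Finset.Ico p (p + W) := by
    intro j hj
    refine Finset.mem_Ico.2 ⟨Finset.min'_le _ j hj, ?_⟩
    by_contra! hge
    have hj' := Finset.mem_filter.1 hj
    have h3 := (ht p hp.1).2.1 (t p) le_rfl
    have h4 := (ht j hj'.1).2.2.1
    rw [hj'.2] at h4
    rw [hp.2] at h3
    have h5 := hx m
    have h6 : η ^ j ≤ η ^ (p + W) := pow_le_pow_of_le_one hη0.le hη1.le hge
    have h7 : 0 < η ^ p := pow_pos hη0 p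
    rw [pow_add] at h6
    have h8 : D * (η * η ^ j) ≤ D * (η * (η ^ p * η ^ W)) := by gcongr
    have h9 : D * h (x (m + 1)) ≤ D * (η * η ^ j) := by gcongr
    have h10 : η * η ^ p * (D * η ^ W) < η * η ^ p * 1 := by gcongr
    have h11 : η * η ^ p < 1 * η ^ p := by gcongr
    linarith
  simpa using Finset.card_le_card hsub

/-! ### Exponential concentration of the total score -/

namespace EdgeGraph

open LevelState

section Concentration

variable {V : Type*} {G : EdgeGraph V}

/-- The exponential moment of a bounded increment with nonpositive drift. -/
lemma LocallyFinite.average_exp_le (hG : G.LocallyFinite) {h φ : V → ℝ} {x : V} {c κ s B : ℝ}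
    (hh : G.average h x ≤ h x) (hκ : 0 ≤ κ) (hs : 0 ≤ s) (hsB : s * B ≤ 1)
    (hφ : ∀ y, G.mult x y ≠ 0 → φ y - c ≤ κ * (h y - h x))
    (hB : ∀ y, G.mult x y ≠ 0 → |φ y - c| ≤ B) :
    G.average (fun y => Real.exp (s * φ y)) x ≤ Real.exp (s ^ 2 * B ^ 2) * Real.exp (s * c) := by
  have hterm : ∀ y, (G.mult x y : ℝ) * Real.exp (s * φ y) ≤
      Real.exp (s * c) * ((1 + s ^ 2 * B ^ 2 - s * κ * h x) * (G.mult x y : ℝ) +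
        s * κ * ((G.mult x y : ℝ) * h y)) := by
    intro y
    by_cases hy : G.mult x y = 0
    · simp [hy]
    have h1 : |s * (φ y - c)| ≤ s * B := by
      rw [abs_mul, abs_of_nonneg hs]
      exact mul_le_mul_of_nonneg_left (hB y hy) hs
    -- The inequality e^u ≤ 1 + u + u² for |u| ≤ 1; the linear term is then replaced by its
    -- majorant, whose average is nonpositive.
    have h2 := (abs_le.1 (Real.abs_exp_sub_one_sub_id_le (h1.trans hsB))).2
    have h3 : (s * (φ y - c)) ^ 2 ≤ s ^ 2 * B ^ 2 := by
      rw [← mul_pow]; exact sq_le_sq.2 (h1.trans (le_abs_self _))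
    have h4 := mul_le_mul_of_nonneg_left (hφ y hy) hs
    have h5 : Real.exp (s * φ y) = Real.exp (s * c) * Real.exp (s * (φ y - c)) := by
      rw [← Real.exp_add]; congr 1; ring
    rw [h5]
    have h6 : Real.exp (s * (φ y - c)) ≤ 1 + s ^ 2 * B ^ 2 - s * κ * h x + s * κ * h y := by
      linarith
    calc _ ≤ (G.mult x y : ℝ) *
          (Real.exp (s * c) * (1 + s ^ 2 * B ^ 2 - s * κ * h x + s * κ * h y)) := by gcongr
      _ = _ := by ring
  have hs1 := (hG.summable_mult x).mul_left (1 + s ^ 2 * B ^ 2 - s * κ * h x)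
  have hs2 := (hG.summable_mult_mul x h).mul_left (s * κ)
  have hsum := (hG.summable_mult_mul x _).tsum_le_tsum hterm ((hs1.add hs2).mul_left _)
  rw [tsum_mul_left, hs1.tsum_add hs2, tsum_mul_left, tsum_mul_left,
    ← hG.realDegree_mul_average, ← realDegree, ← hG.realDegree_mul_average] at hsum
  have hdeg : 0 ≤ G.realDegree x := tsum_nonneg fun _ => Nat.cast_nonneg _
  rcases hdeg.eq_or_lt with hd | hd
  · have : G.average (fun y => Real.exp (s * φ y)) x = 0 := by simp [average, ← hd]
    rw [this]
    positivity
  have h7 : s * κ * G.average h x ≤ s * κ * h x := by gcongr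
  have h8 : 1 + s ^ 2 * B ^ 2 ≤ Real.exp (s ^ 2 * B ^ 2) := by
    linarith [Real.add_one_le_exp (s ^ 2 * B ^ 2)]
  have h9 : G.realDegree x * G.average (fun y => Real.exp (s * φ y)) x ≤
      G.realDegree x * (Real.exp (s ^ 2 * B ^ 2) * Real.exp (s * c)) := by
    refine hsum.trans ?_
    calc _ = G.realDegree x * (Real.exp (s * c) *
          (1 + s ^ 2 * B ^ 2 + (s * κ * G.average h x - s * κ * h x))) := by ring
      _ ≤ G.realDegree x * (Real.exp (s * c) * (Real.exp (s ^ 2 * B ^ 2) + 0)) := by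
        gcongr
        linarith
      _ = _ := by ring
  exact le_of_mul_le_mul_left h9 hd

/-- All levels are driven by the same superharmonic function, so their slopes add up to one κ, while
the increment bound from `sum_ratio_le` stays independent of `J`. -/
lemma average_exp_totalScore_le {D : ℕ} (hD1 : 1 ≤ D) (hD : ∀ v, G.degree v ≤ D) (o : V) {η : ℝ}
    (hη0 : 0 < η) (hη1 : η < 1) {s : ℝ} (hs : 0 ≤ s) (hsB : s * (D * (2 / (1 - η))) ≤ 1)
    (J n : ℕ) (x : ℕ → V) :
    G.average (fun y => Real.exp (s * totalScore η J
      (fun i => G.potential o (Function.update x (n + 1) y i)) (n + 1))) (x n) ≤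
      Real.exp (s ^ 2 * (D * (2 / (1 - η))) ^ 2) *
        Real.exp (s * totalScore η J (fun i => G.potential o (x i)) n) := by
  set w : ℕ → ℝ := fun i => G.potential o (x i)
  have hpos : ∀ j, 0 < η ^ j := fun j => pow_pos hη0 j
  have hscore : ∀ y, totalScore η J (fun i => G.potential o (Function.update x (n + 1) y i))
      (n + 1) = ∑ j ∈ Finset.range J, ((state (η ^ j) η w n).step (η ^ j) η
        (G.potential o y)).score (η ^ j) η (G.potential o y) := by
    intro y
    refine Finset.sum_congr rfl fun j _ => ?_
    have : state (η ^ j) η (fun i => G.potential o (Function.update x (n + 1) y i)) n =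
        state (η ^ j) η w n := by
      refine state_congr fun i hi => ?_
      rw [Function.update_of_ne (by omega)]
    simp only [state, this, Function.update_self]
  simp only [hscore]
  refine (locallyFinite_of_degree_le hD).average_exp_le (h := G.potential o)
    (κ := ∑ j ∈ Finset.range J, (state (η ^ j) η w n).slope (η ^ j))
    ((locallyFinite_of_degree_le hD).average_potential_le o _)
    (Finset.sum_nonneg fun j _ => slope_nonneg (hpos j) _) hs hsB (fun y hy => ?_) fun y hy => ?_
  · rw [totalScore, ← Finset.sum_sub_distrib, Finset.sum_mul]
    exact Finset.sum_le_sum fun j _ => score_step_sub_le (hpos j) _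
  · rw [totalScore, ← Finset.sum_sub_distrib]
    refine (Finset.abs_sum_le_sum_abs _ _).trans ?_
    refine (Finset.sum_le_sum fun j _ => abs_score_step_sub_le (hpos j) hη0 hη1
      (D := D) (by exact_mod_cast hD1) (potential_nonneg o _) (potential_nonneg o y)
      (potential_le_mul hD o hy) (potential_le_mul hD o (by rwa [G.symm]))).trans ?_
    rw [← Finset.mul_sum]
    exact mul_le_mul_of_nonneg_left (sum_ratio_le hη0 hη1 (potential_nonneg o _) J)
      (Nat.cast_nonneg _)

variable [Countable V] [MeasurableSpace V] [DiscreteMeasurableSpace V]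
  {Ω : Type*} [MeasurableSpace Ω] {ν : Measure Ω} {X : ℕ → Ω → V}

omit [Countable V] [MeasurableSpace V] [DiscreteMeasurableSpace V] in
lemma dependsOn_totalScore (h : V → ℝ) (η : ℝ) (J n : ℕ) :
    DependsOn (fun x : ℕ → V => totalScore η J (fun i => h (x i)) n) (Set.Iic n) := by
  intro x x' hx
  refine Finset.sum_congr rfl fun j _ => ?_
  have hn := hx n (Set.mem_Iic.2 le_rfl)
  rw [state_congr (w := fun i => h (x' i)) fun i hi => by rw [hx i (Set.mem_Iic.2 hi)]]
  simp only [hn]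

lemma IsRandomWalk.lintegral_exp_totalScore_le (hX : G.IsRandomWalk ν X) {D : ℕ} (hD1 : 1 ≤ D)
    (hD : ∀ v, G.degree v ≤ D) (o : V) {η : ℝ}
    (hη0 : 0 < η) (hη1 : η < 1) {s : ℝ} (hs : 0 ≤ s) (hsB : s * (D * (2 / (1 - η))) ≤ 1)
    (J n : ℕ) :
    ∫⁻ ω, ENNReal.ofReal (Real.exp
      (s * totalScore η J (fun i => G.potential o (X i ω)) n)) ∂ν ≤
      ENNReal.ofReal (Real.exp (s ^ 2 * (D * (2 / (1 - η))) ^ 2)) ^ n * ν Set.univ := by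
  induction n with
  | zero =>
    have h : ∀ ω, totalScore η J (fun i => G.potential o (X i ω)) 0 = 0 := fun ω =>
      Finset.sum_eq_zero fun j _ => score_state_zero _
    simp [h]
  | succ n ih =>
    have hdep : DependsOn (fun x : ℕ → V => ENNReal.ofReal (Real.exp
        (s * totalScore η J (fun i => G.potential o (x i)) (n + 1)))) (Set.Iic (n + 1)) := by
      intro x x' hx
      have := dependsOn_totalScore (G.potential o) η J (n + 1) hx
      simp only at this ⊢
      rw [this]
    rw [hX.lintegral_succ n hdep, pow_succ', mul_assoc]
    refine le_trans (lintegral_mono fun ω => ?_)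
      ((lintegral_const_mul' _ _ ENNReal.ofReal_ne_top).trans_le (mul_le_mul_right ih _))
    rw [(locallyFinite_of_degree_le hD).tsum_transition_mul_ofReal (f := fun y => Real.exp
      (s * totalScore η J (fun i => G.potential o
        (Function.update (fun i => X i ω) (n + 1) y i)) (n + 1))) (fun y => (Real.exp_pos _).le),
      ← ENNReal.ofReal_mul (Real.exp_pos _).le]
    exact ENNReal.ofReal_le_ofReal
      (average_exp_totalScore_le hD1 hD o hη0 hη1 hs hsB J n fun i => X i ω)

/-- A Chernoff bound and Borel–Cantelli. The number of levels may grow with n because the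
exponential moment does not see it. -/
lemma IsRandomWalk.eventually_totalScore_le [IsFiniteMeasure ν] (hX : G.IsRandomWalk ν X) {D : ℕ}
    (hD1 : 1 ≤ D) (hD : ∀ v, G.degree v ≤ D) (o : V) {η : ℝ} (hη0 : 0 < η) (hη1 : η < 1) :
    ∀ᵐ ω ∂ν, ∀ᶠ n : ℕ in atTop,
      totalScore η (2 * n) (fun i => G.potential o (X i ω)) n ≤ (1 - η) / 2 * n := by
  set ε := (1 - η) / 2 with hε
  have hε0 : 0 < ε := by linarith
  set B : ℝ := D * (2 / (1 - η)) with hBdef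
  have hD1' : (1 : ℝ) ≤ D := by exact_mod_cast hD1
  have hBε : B = D / ε := by rw [hBdef, hε]; field_simp
  have hB0 : 0 < B := by rw [hBε]; positivity
  have hB1 : ε ≤ 2 * B := by
    have : 1 ≤ B := by
      rw [hBε, le_div_iff₀ hε0]
      linarith
    linarith
  -- This minimises the exponent s²B² − sε, with minimum −sε/2.
  set s := ε / (2 * B ^ 2) with hsdef
  have hs0 : 0 ≤ s := by positivity
  have hsB : s * B ≤ 1 := by
    have : s * B = ε / (2 * B) := by rw [hsdef]; field_simp
    rw [this]
    exact (div_le_one (by positivity)).2 hB1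
  set q := Real.exp (-(s * ε / 2)) with hq
  have hq1 : q < 1 := by
    rw [hq, Real.exp_lt_one_iff]
    have : 0 < s := by positivity
    have : 0 < s * ε / 2 := by positivity
    linarith
  have htail : ∀ n : ℕ, ν {ω | ¬ totalScore η (2 * n) (fun i => G.potential o (X i ω)) n ≤ ε * n} ≤
      ENNReal.ofReal (q ^ n) * ν Set.univ := by
    intro n
    have hm : Measurable fun ω => ENNReal.ofReal (Real.exp
        (s * totalScore η (2 * n) (fun i => G.potential o (X i ω)) n)) := by
      refine hX.measurable_comp n (F := fun x => ENNReal.ofReal (Real.exp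
        (s * totalScore η (2 * n) (fun i => G.potential o (x i)) n))) fun x x' hx => ?_
      have := dependsOn_totalScore (G.potential o) η (2 * n) n hx
      simp only at this ⊢
      rw [this]
    have h1 := mul_meas_ge_le_lintegral (μ := ν) hm (ENNReal.ofReal (Real.exp (s * (ε * n))))
    have h2 := h1.trans (hX.lintegral_exp_totalScore_le hD1 hD o hη0 hη1 hs0 hsB (2 * n) n)
    have h3 : ν {ω | ¬ totalScore η (2 * n) (fun i => G.potential o (X i ω)) n ≤ ε * n} ≤
        ν {ω | ENNReal.ofReal (Real.exp (s * (ε * n))) ≤ ENNReal.ofReal (Real.exp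
          (s * totalScore η (2 * n) (fun i => G.potential o (X i ω)) n))} := by
      refine measure_mono fun ω hω => ?_
      refine ENNReal.ofReal_le_ofReal (Real.exp_le_exp.2 (mul_le_mul_of_nonneg_left ?_ hs0))
      exact (not_le.1 hω).le
    have h4 : ENNReal.ofReal (Real.exp (-(s * (ε * n)))) *
        ENNReal.ofReal (Real.exp (s * (ε * n))) = 1 := by
      rw [← ENNReal.ofReal_mul (Real.exp_pos _).le, ← Real.exp_add]
      simp
    calc _ ≤ _ := h3
      _ = ENNReal.ofReal (Real.exp (-(s * (ε * n)))) * (ENNReal.ofReal (Real.exp (s * (ε * n))) *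
          ν {ω | ENNReal.ofReal (Real.exp (s * (ε * n))) ≤ ENNReal.ofReal (Real.exp
          (s * totalScore η (2 * n) (fun i => G.potential o (X i ω)) n))}) := by
        rw [← mul_assoc (ENNReal.ofReal (Real.exp (-(s * (ε * n))))), h4, one_mul]
      _ ≤ ENNReal.ofReal (Real.exp (-(s * (ε * n)))) *
          (ENNReal.ofReal (Real.exp (s ^ 2 * B ^ 2)) ^ n * ν Set.univ) := mul_le_mul_right h2 _
      _ = ENNReal.ofReal (q ^ n) * ν Set.univ := by
        rw [← mul_assoc, ← ENNReal.ofReal_pow (Real.exp_pos _).le,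
          ← ENNReal.ofReal_mul (Real.exp_pos _).le, ← Real.exp_nat_mul, ← Real.exp_add, hq,
          ← Real.exp_nat_mul]
        congr 3
        have : s * B ^ 2 = ε / 2 := by rw [hsdef]; field_simp
        have e : s ^ 2 * B ^ 2 = s * (ε / 2) := by rw [← this]; ring
        rw [e]
        ring
  have hsum : ∑' n : ℕ,
      ν {ω | ¬ totalScore η (2 * n) (fun i => G.potential o (X i ω)) n ≤ ε * n} ≠ ∞ := by
    refine ne_top_of_le_ne_top ?_ (ENNReal.tsum_le_tsum htail)
    rw [ENNReal.tsum_mul_right, ← ENNReal.ofReal_tsum_of_nonneg (fun n => by positivity)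
      (summable_geometric_of_lt_one (Real.exp_pos _).le hq1)]
    exact ENNReal.mul_ne_top ENNReal.ofReal_ne_top (measure_ne_top _ _)
  filter_upwards [ae_eventually_notMem hsum] with ω hω
  filter_upwards [hω] with n hn
  simpa using hn

/-- If the walk has positive speed, then its cut times have positive density. -/
lemma IsRandomWalk.exists_density [IsFiniteMeasure ν] [NeZero ν] (hX : G.IsRandomWalk ν X) {D : ℕ}
    (hD1 : 1 ≤ D) (hD : ∀ v, G.degree v ≤ D) {o : V} (h0 : ∀ᵐ ω ∂ν, X 0 ω = o) {k : ℕ}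
    (hk : 0 < k) : ∃ δ : ℝ, 0 < δ ∧ ∀ N : ℕ, ∀ᵐ ω ∂ν,
      (∀ i ≥ N, (i : ℕ∞) ≤ k * G.toSimpleGraph.edist o (X i ω)) →
      ∀ᶠ n : ℕ in atTop, δ * n ≤ cutTimeCount (fun i => X i ω) n := by
  obtain ⟨β, hβ0, hβ1, hβ⟩ := hX.eventually_potential_lt hD h0 hk
  -- With this choice η^(2n) = β^n: the decay rate takes h below 2n levels in n steps.
  set η := √β with hη
  have hη0 : 0 < η := Real.sqrt_pos.2 hβ0
  have hη1 : η < 1 := by rw [hη, Real.sqrt_lt' one_pos]; simpa using hβ1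
  have hηβ : η ^ 2 = β := Real.sq_sqrt hβ0.le
  have hD0 : (0 : ℝ) < D := by exact_mod_cast hD1
  obtain ⟨W, hW⟩ := exists_pow_lt_of_lt_one (inv_pos.2 hD0) hη1
  have hW' : D * η ^ (W + 1) < 1 := by
    have h1 : D * η ^ W < 1 := by
      rw [← mul_inv_cancel₀ hD0.ne']
      gcongr
    have h2 : η ^ (W + 1) ≤ η ^ W := pow_le_pow_of_le_one hη0.le hη1.le (Nat.le_succ W)
    exact (mul_le_mul_of_nonneg_left h2 hD0.le).trans_lt h1
  refine ⟨(1 - η) / 2 / (W + 1 : ℕ), div_pos (by linarith) (by positivity), fun N => ?_⟩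
  filter_upwards [hβ N, hX.eventually_totalScore_le hD1 hD o hη0 hη1, hX.ae_mult_ne_zero, h0]
    with ω h1 h2 h3 h4 hE
  obtain ⟨M, hM⟩ := eventually_atTop.1 (h1 hE)
  filter_upwards [h2, eventually_ge_atTop M] with n hn hnM
  have hlt : ∀ i ≥ n, G.potential o (X i ω) < η ^ (2 * n) := by
    intro i hi
    rw [pow_mul, hηβ]
    exact (hM i (hnM.trans hi)).trans_le (pow_le_pow_of_le_one hβ0.le hβ1.le hi)
  have h5 := le_card_alive hη0 hη1 (w := fun i => G.potential o (X i ω))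
    (by simp only [h4, potential_self, le_refl]) (potential_nonneg o _) (hlt n le_rfl) hn
  have h6 := card_alive_le_mul_cutTimeCount hη0 hη1 hD0 hW' (h := G.potential o)
    (x := fun i => X i ω) (fun i => potential_le_mul hD o (by rw [G.symm]; exact h3 i)) hlt
  rw [div_mul_eq_mul_div, div_le_iff₀ (by positivity), mul_comm (cutTimeCount _ n : ℝ)]
  exact h5.trans (by exact_mod_cast h6)

end Concentration

/-- Restricting without normalising preserves the product formula, so a random initial vertex
reduces to a deterministic one under a finite measure. -/
lemma IsRandomWalk.restrict_start {V : Type*} [MeasurableSpace V] [DiscreteMeasurableSpace V]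
    {G : EdgeGraph V} {Ω : Type*} [MeasurableSpace Ω] {μ : Measure Ω} {X : ℕ → Ω → V}
    (hX : G.IsRandomWalk μ X) (o : V) : G.IsRandomWalk (μ.restrict {ω | X 0 ω = o}) X where
  measurable := hX.measurable
  law n x := by
    have hm : MeasurableSet {ω | X 0 ω = o} := hX.measurable 0 (measurableSet_singleton o)
    rw [Measure.restrict_apply' hm, Measure.restrict_apply' hm]
    by_cases hx : x 0 = o
    · have h1 : {ω | ∀ i ≤ n, X i ω = x i} ∩ {ω | X 0 ω = o} = {ω | ∀ i ≤ n, X i ω = x i} :=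
        Set.inter_eq_left.2 fun ω h => (h 0 (Nat.zero_le n)).trans hx
      have h2 : {ω | X 0 ω = x 0} ∩ {ω | X 0 ω = o} = {ω | X 0 ω = x 0} :=
        Set.inter_eq_left.2 fun ω h => Eq.trans h hx
      rw [h1, h2, hX.law]
    · have h1 : {ω | ∀ i ≤ n, X i ω = x i} ∩ {ω | X 0 ω = o} = ∅ := by
        refine Set.disjoint_iff_inter_eq_empty.1 (Set.disjoint_left.2 fun ω h h' => hx ?_)
        exact (h 0 (Nat.zero_le n)).symm.trans h'
      have h2 : {ω | X 0 ω = x 0} ∩ {ω | X 0 ω = o} = ∅ := by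
        refine Set.disjoint_iff_inter_eq_empty.1 (Set.disjoint_left.2 fun ω h h' => hx ?_)
        exact (Eq.symm h).trans h'
      rw [h1, h2]
      simp

end EdgeGraph

/-! ### Lower limits and the conclusion -/

/-- A sequence with positive lower speed has speed at least `1 / k` for some `k`. -/
lemma exists_le_mul_of_liminf_pos {r : ℕ → ℕ∞}
    (h : 0 < liminf (fun n : ℕ => ((r n : ℕ∞) : ℝ≥0∞) / (n : ℝ≥0∞)) atTop) :
    ∃ k : ℕ, 0 < k ∧ ∃ N : ℕ, ∀ i ≥ N, (i : ℕ∞) ≤ k * r i := by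
  obtain ⟨k, hk⟩ := ENNReal.exists_inv_nat_lt h.ne'
  have hk0 : k ≠ 0 := by
    rintro rfl
    simp at hk
  obtain ⟨N, hN⟩ := eventually_atTop.1 (eventually_lt_of_lt_liminf hk)
  refine ⟨k, Nat.pos_of_ne_zero hk0, N, fun i hi => ?_⟩
  rcases Nat.eq_zero_or_pos i with rfl | hi0
  · simp
  have h1 := (hN i hi).le
  have hi' : (i : ℝ≥0∞) ≠ 0 := by exact_mod_cast hi0.ne'
  rw [ENNReal.le_div_iff_mul_le (Or.inl hi') (Or.inl (ENNReal.natCast_ne_top _)), mul_comm,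
    ← div_eq_mul_inv, ENNReal.div_le_iff_le_mul (Or.inl (by exact_mod_cast hk0))
      (Or.inl (ENNReal.natCast_ne_top _)), mul_comm] at h1
  exact_mod_cast h1

lemma liminf_pos_of_eventually_le {c : ℕ → ℕ} {δ : ℝ} (hδ : 0 < δ)
    (h : ∀ᶠ n : ℕ in atTop, δ * n ≤ c n) :
    0 < liminf (fun n : ℕ => (c n : ℝ≥0∞) / (n : ℝ≥0∞)) atTop := by
  refine (ENNReal.ofReal_pos.2 hδ).trans_le (le_liminf_of_le (by isBoundedDefault) ?_)
  filter_upwards [h, eventually_gt_atTop 0] with n hn hn0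
  have hn' : (n : ℝ≥0∞) ≠ 0 := by exact_mod_cast hn0.ne'
  rw [ENNReal.le_div_iff_mul_le (Or.inl hn') (Or.inl (ENNReal.natCast_ne_top _)),
    ← ENNReal.ofReal_natCast n, ← ENNReal.ofReal_mul hδ.le, ← ENNReal.ofReal_natCast (c n)]
  exact ENNReal.ofReal_le_ofReal hn

theorem theorem1p4 {V : Type*} [Countable V] [MeasurableSpace V] [DiscreteMeasurableSpace V]
    (G : EdgeGraph V) (hG : G.BoundedDegree)
    {Ω : Type*} [MeasurableSpace Ω] (μ : Measure Ω) [IsProbabilityMeasure μ]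
    (X : ℕ → Ω → V) (hX : G.IsRandomWalk μ X)
    (hspeed : ∀ᵐ ω ∂μ,
      0 < liminf (fun n : ℕ => G.gdist (X 0 ω) (X n ω) / (n : ℝ≥0∞)) atTop) :
    ∀ᵐ ω ∂μ,
      0 < liminf (fun n : ℕ => (cutTimeCount (fun i => X i ω) n : ℝ≥0∞) / (n : ℝ≥0∞)) atTop := by
  obtain ⟨D₀, hD₀⟩ := hG
  have hD : ∀ v, G.degree v ≤ (D₀ + 1 : ℕ) := fun v =>
    (hD₀ v).trans (by exact_mod_cast Nat.le_succ D₀)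
  have hmain : ∀ (o : V) (k N : ℕ), 0 < k → ∀ᵐ ω ∂μ, X 0 ω = o →
      (∀ i ≥ N, (i : ℕ∞) ≤ k * G.toSimpleGraph.edist o (X i ω)) →
      0 < liminf (fun n : ℕ =>
        (cutTimeCount (fun i => X i ω) n : ℝ≥0∞) / (n : ℝ≥0∞)) atTop := by
    intro o k N hk
    have hm : MeasurableSet {ω | X 0 ω = o} := hX.measurable 0 (measurableSet_singleton o)
    refine (ae_restrict_iff' hm).1 ?_
    rcases eq_or_ne (μ.restrict {ω | X 0 ω = o}) 0 with hz | hz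
    · simp [hz]
    have : NeZero (μ.restrict {ω | X 0 ω = o}) := ⟨hz⟩
    obtain ⟨δ, hδ, h⟩ := (hX.restrict_start o).exists_density (Nat.le_add_left 1 D₀) hD
      (ae_restrict_mem hm) hk
    filter_upwards [h N] with ω hω hE using liminf_pos_of_eventually_le hδ (hω hE)
  -- The exceptional null sets are indexed by the countable family of triples (o, k, N), so they can
  -- be discarded together before `o`, `k` and `N` are chosen depending on ω.
  have hall : ∀ᵐ ω ∂μ, ∀ (o : V) (k N : ℕ), 0 < k → X 0 ω = o →
      (∀ i ≥ N, (i : ℕ∞) ≤ k * G.toSimpleGraph.edist o (X i ω)) →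
      0 < liminf (fun n : ℕ =>
        (cutTimeCount (fun i => X i ω) n : ℝ≥0∞) / (n : ℝ≥0∞)) atTop := by
    simp only [ae_all_iff]
    exact hmain
  filter_upwards [hall, hspeed] with ω h1 h2
  obtain ⟨k, hk, N, hN⟩ := exists_le_mul_of_liminf_pos h2
  exact h1 (X 0 ω) k N hk rfl hN
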